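/- **Setting.** Let $\Gamma$ be a countable group with a left-invariant metric $d$; for $\Omega,\Omega'\subset\Gamma$ put $d(\Omega,\Omega')=\inf\{d(\gamma,\gamma'):\gamma\in\Omega,\gamma'\in\Omega'\}$ ($=\infty$ if one set is empty). For finite $\Omega\subset\Gamma$ and $r\ge 0$ let $\partial_r\Omega=\{\gamma\in\Gamma: d(\gamma,\Omega)\le r,\ d(\gamma,\Gamma\setminus\Omega)\le r\}$ and $\mathrm{int}_r\Omega=\Omega\setminus\partial_r\Omega$. Let $X$ be a compact topological space on which $\Gamma$ acts by homeomorphisms, let $f_o:X\to\mathbb R$ be continuous with $f_o(X)=[0,1]$, and put $f_\Omega(x)=\frac1{|\Omega|}\sum_{\gamma\in\Omega}f_o(\gamma^{-1}x)$ (any convention for $\Omega=\emptyset$). Let $F$ be a field and $H^\star(X;F)=\bigoplus_n H^n(X;F)$ the singular cohomology algebra with the cup product $\wedge$. Subalgebras are not required to contain $1$; a subalgebra is graded if it contains the pure-degree components of its elements. For a subalgebra $A$ and finite $\Omega\subset\Gamma$ let $A_\Omega$ be the subalgebra generated by the translates $(\gamma^{-1})^*A$, $\gamma\in\Omega$. Assume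 that the action is *product-like*: there are a subalgebra $\mathfrak a\subset H^\star(X;F)$, containing some nonzero finite-dimensional graded subalgebra, and numbers $N(A)\ge0$, one for each finite-dimensional graded subalgebra $A\subset\mathfrak a$, such that for all finite $\Omega,\Omega'\subset\Gamma$ with $d(\Omega,\Omega')>N(A)$ the map $A_\Omega\otimes A_{\Omega'}\to A_{\Omega\cup\Omega'}$, $a\otimes a'\mapsto a\wedge a'$, is injective. Fix $\mathfrak a$ and $N$ as above, a finite-dimensional graded subalgebra $A\subset\mathfrak a$, and a number $r\ge0$ such that any $\gamma,\gamma'\in\Gamma$ with $d(\gamma,\gamma')\le N(A)$ admit some $z\in\Gamma$ with $d(\gamma,z)\le r$ and $d(z,\gamma')\le r$. (One may always take $r=N(A)$; one may take $r=N(A)/2$ if, for instance, $d$ is a word metric and $N(A)$ is an even integer.) Put $\widetilde\Omega=\mathrm{int}_r\Omega$. For $O\subset X$ open and a class $a$, write $\operatorname{supp}a\subset O$ if $a$ restricts to $0$ on some open set $O'$ with $O\cup O'=X$. For $\ell\ge0$, $\nu,\delta>0$, $c\in[0,1]$ let $b^{\ell,\nu}_{A,\Omega}(c,\delta)$, the *homological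 measure*, be the rank of the linear map $a\mapsto(b\mapsto a\wedge b)$ from $$\{a\in A_{\widetilde\Omega}:\operatorname{supp}a\subset f_\Omega^{-1}(-\infty,c+\delta),\ \text{every nonzero pure component of } a \text{ has degree in } ((\ell-\nu)|\Omega|,(\ell+\nu)|\Omega|)\}$$ to $$\mathrm{Hom}\bigl(\{b\in A_{\widetilde\Omega}:\operatorname{supp}b\subset f_\Omega^{-1}(c-\delta,\infty)\},\ \{e\in A_{\widetilde\Omega}:\operatorname{supp}e\subset f_\Omega^{-1}(c-\delta,c+\delta)\}\bigr).$$ **Claim.** Let $\nu,\delta>0$ and let $\Omega,\Omega'\subset\Gamma$ be disjoint finite subsets. Then, for all $\ell\ge0$ and $c\in[0,1]$, $$b^{\ell,\nu}_{A,\Omega\cup\Omega'}(c,\delta)\ \ge\ b^{\ell,\nu}_{A,\Omega}(c,\delta)\cdot b^{\ell,\nu}_{A,\Omega'}(c,\delta).$$ More generally, with $\alpha=|\Omega|/|\Omega\cup\Omega'|$, for all $\ell,\ell'\ge0$ and $c,c'\in[0,1]$, $$b^{\alpha\ell+(1-\alpha)\ell',\,\nu}_{A,\Omega\cup\Omega'}\bigl(\alpha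 c+(1-\alpha)c',\delta\bigr)\ \ge\ b^{\ell,\nu}_{A,\Omega}(c,\delta)\cdot b^{\ell',\nu}_{A,\Omega'}(c',\delta).$$ -/

import Mathlib

open scoped DirectSum TensorProduct ENNReal

noncomputable section

namespace HomMeasure

/-! ### Singular cohomology with coefficients in a field, with its cup product -/

section Cochains

variable (F : Type*) [Field F] (X : Type*) [TopologicalSpace X]

/-- Singular `n`-simplices of `X`: continuous maps from the standard `n`-simplex to `X`. -/
abbrev Simplex (n : ℕ) : Type _ := C(stdSimplex ℝ (Fin (n + 1)), X)

/-- Singular `n`-cochains of `X` with coefficients in `F`. -/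
abbrev Cochain (n : ℕ) : Type _ := Simplex X n → F

variable {X}

/-- Restriction of a singular simplex along the affine map of standard simplices which sends the
`i`-th vertex to the `f i`-th vertex. -/
def Simplex.res {m n : ℕ} (σ : Simplex X n) (f : Fin (m + 1) → Fin (n + 1)) : Simplex X m :=
  σ.comp ⟨stdSimplex.map f, stdSimplex.continuous_map f⟩

theorem Simplex.res_res {k m n : ℕ} (σ : Simplex X n) (f : Fin (m + 1) → Fin (n + 1))
    (g : Fin (k + 1) → Fin (m + 1)) : (σ.res f).res g = σ.res (f ∘ g) := by
  ext x
  simp only [Simplex.res, ContinuousMap.comp_apply, ContinuousMap.coe_mk,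
    stdSimplex.map_comp_apply]

variable {F}

/-- The coboundary `(dφ)(σ) = ∑ᵢ (-1)ⁱ φ(σ ∘ δᵢ)`, where `δᵢ` is the inclusion of the face opposite
to the `i`-th vertex. -/
def coboundary (n : ℕ) : Cochain F X n →ₗ[F] Cochain F X (n + 1) where
  toFun φ σ := ∑ i : Fin (n + 2), (-1) ^ (i : ℕ) * φ (σ.res i.succAbove)
  map_add' φ ψ := by
    funext σ
    simp [mul_add, Finset.sum_add_distrib]
  map_smul' c φ := by
    funext σ
    simp [Finset.mul_sum, mul_left_comm]

/-- The front `p`-face `[v₀, …, v_p]` of an `n`-simplex. -/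
def frontFace {p q n : ℕ} (h : p + q = n) (i : Fin (p + 1)) : Fin (n + 1) :=
  ⟨i, by omega⟩

/-- The back `q`-face `[v_p, …, v_{p+q}]` of an `n`-simplex, `n = p + q`. -/
def backFace {p q n : ℕ} (h : p + q = n) (i : Fin (q + 1)) : Fin (n + 1) :=
  ⟨p + i, by omega⟩

/-- The cup product of cochains,
`(φ ∪ ψ)(σ) = φ(σ|[v₀, …, v_p]) ψ(σ|[v_p, …, v_{p+q}])`. -/
def cup {p q n : ℕ} (h : p + q = n) :
    Cochain F X p →ₗ[F] Cochain F X q →ₗ[F] Cochain F X n :=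
  LinearMap.mk₂ F (fun φ ψ σ => φ (σ.res (frontFace h)) * ψ (σ.res (backFace h)))
    (fun φ φ' ψ => by funext σ; simp [add_mul])
    (fun c φ ψ => by funext σ; simp [mul_assoc])
    (fun φ ψ ψ' => by funext σ; simp [mul_add])
    (fun c φ ψ => by funext σ; simp [mul_left_comm])

theorem coboundary_apply {n : ℕ} (φ : Cochain F X n) (σ : Simplex X (n + 1)) :
    coboundary n φ σ = ∑ i : Fin (n + 2), (-1) ^ (i : ℕ) * φ (σ.res i.succAbove) := rfl

theorem cup_apply {p q n : ℕ} (h : p + q = n) (φ : Cochain F X p) (ψ : Cochain F X q)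
    (σ : Simplex X n) :
    cup h φ ψ σ = φ (σ.res (frontFace h)) * ψ (σ.res (backFace h)) := rfl

/-- The Leibniz rule `d(φ ∪ ψ) = dφ ∪ ψ + (-1)ᵖ φ ∪ dψ`. -/
theorem coboundary_cup {p q n : ℕ} (h : p + q = n) (φ : Cochain F X p) (ψ : Cochain F X q) :
    coboundary n (cup h φ ψ) =
      cup (show (p + 1) + q = n + 1 by omega) (coboundary p φ) ψ +
        (-1 : F) ^ p • cup (show p + (q + 1) = n + 1 by omega) φ (coboundary q ψ) := by
  subst h
  funext σ
  have e : (p + 1) + (q + 1) = p + q + 2 := by omega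
  simp only [Pi.add_apply, Pi.smul_apply, smul_eq_mul, coboundary_apply, cup_apply,
    Simplex.res_res]
  rw [← (finCongr e).sum_comp, Fin.sum_univ_add, Fin.sum_univ_castSucc (n := p + 1),
    Fin.sum_univ_succ (n := q + 1)]
  have h1 : ∀ i : Fin (p + 1),
      ((finCongr e) (Fin.castAdd (q + 1) i)).succAbove ∘
          frontFace (show p + q = p + q from rfl) =
        frontFace (show (p + 1) + q = p + q + 1 by omega) ∘ i.castSucc.succAbove := by
    intro i; funext j; ext
    simp only [Function.comp, frontFace, Fin.succAbove, Fin.lt_def, finCongr_apply]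
    split_ifs <;> simp_all <;> omega
  have h2 : ∀ i : Fin (p + 1),
      ((finCongr e) (Fin.castAdd (q + 1) i)).succAbove ∘
          backFace (show p + q = p + q from rfl) =
        backFace (show (p + 1) + q = p + q + 1 by omega) := by
    intro i; funext j; ext
    simp only [Function.comp, backFace, Fin.succAbove, Fin.lt_def, finCongr_apply]
    have := i.2
    split_ifs <;> simp_all <;> omega
  have h3 : ∀ i : Fin (q + 1),
      ((finCongr e) (Fin.natAdd (p + 1) i)).succAbove ∘
          frontFace (show p + q = p + q from rfl) =
        frontFace (show p + (q + 1) = p + q + 1 by omega) := by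
    intro i; funext j; ext
    simp only [Function.comp, frontFace, Fin.succAbove, Fin.lt_def, finCongr_apply]
    have := j.2
    split_ifs <;> simp_all <;> omega
  have h4 : ∀ i : Fin (q + 1),
      ((finCongr e) (Fin.natAdd (p + 1) i)).succAbove ∘
          backFace (show p + q = p + q from rfl) =
        backFace (show p + (q + 1) = p + q + 1 by omega) ∘ i.succ.succAbove := by
    intro i; funext j; ext
    simp only [Function.comp, backFace, Fin.succAbove, Fin.lt_def, finCongr_apply]
    split_ifs <;> simp_all <;> omega
  have h5 : frontFace (show (p + 1) + q = p + q + 1 by omega) ∘ (Fin.last (p + 1)).succAbove =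
      frontFace (show p + (q + 1) = p + q + 1 by omega) := by
    funext j; ext
    simp [frontFace]
  have h6 : backFace (show p + (q + 1) = p + q + 1 by omega) ∘ (0 : Fin (q + 2)).succAbove =
      backFace (show (p + 1) + q = p + q + 1 by omega) := by
    funext j; ext
    simp [backFace]
    omega
  simp only [h1, h2, h3, h4, h5, h6]
  simp only [finCongr_apply, Fin.val_cast, Fin.val_castAdd, Fin.val_natAdd, Fin.val_castSucc,
    Fin.val_last, Fin.val_succ, Fin.val_zero, add_mul, mul_add, Finset.sum_mul, Finset.mul_sum]
  have key : ∀ a b c x y d : F, a = c → x + y = 0 → b = d → a + b = c + x + (y + d) := by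
    intro a b c x y d h h' h''
    rw [h, h'', add_assoc, ← add_assoc x, h', zero_add]
  exact key _ _ _ _ _ _ (Finset.sum_congr rfl fun i _ => by ring) (by ring)
    (Finset.sum_congr rfl fun i _ => by ring)

variable (F X)

/-- The `n`-cocycles. -/
def cocycles (n : ℕ) : Submodule F (Cochain F X n) := LinearMap.ker (coboundary n)

/-- The `n`-coboundaries. -/
def coboundaries : (n : ℕ) → Submodule F (Cochain F X n)
  | 0 => ⊥
  | n + 1 => LinearMap.range (coboundary n)

/-- The `n`-th singular cohomology space `Hⁿ(X; F)`. -/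
def H (n : ℕ) : Type _ := cocycles F X n ⧸ (coboundaries F X n).submoduleOf (cocycles F X n)

instance (n : ℕ) : AddCommGroup (H F X n) :=
  inferInstanceAs (AddCommGroup (_ ⧸ (coboundaries F X n).submoduleOf (cocycles F X n)))

instance (n : ℕ) : Module F (H F X n) :=
  inferInstanceAs (Module F (_ ⧸ (coboundaries F X n).submoduleOf (cocycles F X n)))

variable {F X}

theorem cup_mem_cocycles {p q n : ℕ} (h : p + q = n) {φ : Cochain F X p} {ψ : Cochain F X q}
    (hφ : φ ∈ cocycles F X p) (hψ : ψ ∈ cocycles F X q) : cup h φ ψ ∈ cocycles F X n := by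
  simp only [cocycles, LinearMap.mem_ker] at hφ hψ ⊢
  rw [coboundary_cup, hφ, hψ]
  simp

theorem cup_mem_coboundaries_left {p q n : ℕ} (h : p + q = n) {φ : Cochain F X p}
    {ψ : Cochain F X q} (hφ : φ ∈ coboundaries F X p) (hψ : ψ ∈ cocycles F X q) :
    cup h φ ψ ∈ coboundaries F X n := by
  cases p with
  | zero =>
    rw [(Submodule.mem_bot F).1 hφ]
    simp
  | succ p =>
    obtain ⟨η, rfl⟩ := hφ
    obtain rfl : n = (p + q) + 1 := by omega
    refine ⟨cup rfl η ψ, ?_⟩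
    rw [coboundary_cup, LinearMap.mem_ker.1 hψ]
    simp

theorem cup_mem_coboundaries_right {p q n : ℕ} (h : p + q = n) {φ : Cochain F X p}
    {ψ : Cochain F X q} (hφ : φ ∈ cocycles F X p) (hψ : ψ ∈ coboundaries F X q) :
    cup h φ ψ ∈ coboundaries F X n := by
  cases q with
  | zero =>
    rw [(Submodule.mem_bot F).1 hψ]
    simp
  | succ q =>
    obtain ⟨η, rfl⟩ := hψ
    obtain rfl : n = (p + q) + 1 := by omega
    refine ⟨(-1 : F) ^ p • cup rfl φ η, ?_⟩
    rw [map_smul, coboundary_cup, LinearMap.mem_ker.1 hφ]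
    simp [smul_smul, ← mul_pow]

/-- The cup product of cocycles. -/
def cupCocycles (p q : ℕ) :
    cocycles F X p →ₗ[F] cocycles F X q →ₗ[F] cocycles F X (p + q) :=
  LinearMap.mk₂ F (fun φ ψ => ⟨cup rfl φ.1 ψ.1, cup_mem_cocycles rfl φ.2 ψ.2⟩)
    (fun φ φ' ψ => by ext1; simp)
    (fun c φ ψ => by ext1; simp)
    (fun φ ψ ψ' => by ext1; simp)
    (fun c φ ψ => by ext1; simp)

/-- The cup product `Hᵖ(X; F) × H^q(X; F) → H^{p+q}(X; F)`. -/
def cupH (p q : ℕ) : H F X p →ₗ[F] H F X q →ₗ[F] H F X (p + q) :=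
  Submodule.liftQ ((coboundaries F X p).submoduleOf (cocycles F X p))
    (LinearMap.flip <|
      Submodule.liftQ ((coboundaries F X q).submoduleOf (cocycles F X q))
        (LinearMap.flip <| (cupCocycles p q).compr₂
          (Submodule.mkQ ((coboundaries F X (p + q)).submoduleOf (cocycles F X (p + q)))))
        (by
          intro ψ hψ
          ext1 φ
          exact (Submodule.Quotient.mk_eq_zero _).2 (cup_mem_coboundaries_right rfl φ.2 hψ)))
    (by
      intro φ hφ
      rw [LinearMap.mem_ker]
      apply LinearMap.ext
      intro ψ
      obtain ⟨ψ, rfl⟩ := Submodule.mkQ_surjective _ ψ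
      exact (Submodule.Quotient.mk_eq_zero _).2 (cup_mem_coboundaries_left rfl hφ ψ.2))

instance : DirectSum.GNonUnitalNonAssocSemiring (fun n => H F X n) where
  mul a b := cupH _ _ a b
  mul_zero a := map_zero _
  zero_mul b := by simp
  mul_add a b c := map_add _ _ _
  add_mul a b c := by simp

variable (F X)

/-- The singular cohomology algebra `H⋆(X; F) = ⨁ₙ Hⁿ(X; F)` with the cup product as
multiplication. The `n`-th component of a class `a` is `a n`. Associativity and the unit are not
needed to speak of its (not necessarily unital) subalgebras. -/
abbrev Cohomology : Type _ := ⨁ n, H F X n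

instance : NonUnitalNonAssocRing (Cohomology F X) := DirectSum.nonAssocRing _

variable {F X}

theorem of_mul_of {p q : ℕ} (a : H F X p) (b : H F X q) :
    (DirectSum.of (H F X) p a * DirectSum.of (H F X) q b : Cohomology F X) =
      DirectSum.of (H F X) (p + q) (cupH p q a b) :=
  DirectSum.of_mul_of a b

theorem smul_of (c : F) {p : ℕ} (a : H F X p) :
    c • DirectSum.of (H F X) p a = DirectSum.of (H F X) p (c • a) :=
  (DirectSum.of_smul (M := H F X) F p c a).symm

instance : IsScalarTower F (Cohomology F X) (Cohomology F X) where
  smul_assoc c a b := by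
    simp only [smul_eq_mul]
    induction a using DirectSum.induction_on with
    | zero => simp
    | add a a' ha ha' => simp [add_mul, smul_add, ha, ha']
    | of p a =>
      induction b using DirectSum.induction_on with
      | zero => simp
      | add b b' hb hb' => simp [mul_add, smul_add, hb, hb']
      | of q b => simp [smul_of, of_mul_of]

instance : SMulCommClass F (Cohomology F X) (Cohomology F X) where
  smul_comm c a b := by
    simp only [smul_eq_mul]
    induction a using DirectSum.induction_on with
    | zero => simp
    | add a a' ha ha' => simp [add_mul, smul_add, ha, ha']
    | of p a =>
      induction b using DirectSum.induction_on with
      | zero => simp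
      | add b b' hb hb' => simp [mul_add, smul_add, hb, hb']
      | of q b => simp [smul_of, of_mul_of]

end Cochains

section Pullback

variable (F : Type*) [Field F] {X Y : Type*} [TopologicalSpace X] [TopologicalSpace Y]

/-- The pullback of cochains along a continuous map. -/
def pullbackCochain (g : C(X, Y)) (n : ℕ) : Cochain F Y n →ₗ[F] Cochain F X n where
  toFun φ σ := φ (g.comp σ)
  map_add' _ _ := rfl
  map_smul' _ _ := rfl

theorem pullbackCochain_coboundary (g : C(X, Y)) (n : ℕ) (φ : Cochain F Y n) :
    pullbackCochain F g (n + 1) (coboundary n φ) = coboundary n (pullbackCochain F g n φ) := rfl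

theorem pullback_mem_cocycles (g : C(X, Y)) (n : ℕ) :
    ∀ φ ∈ cocycles F Y n, pullbackCochain F g n φ ∈ cocycles F X n := by
  intro φ hφ
  rw [cocycles, LinearMap.mem_ker, ← pullbackCochain_coboundary, LinearMap.mem_ker.1 hφ, map_zero]

theorem pullback_mem_coboundaries (g : C(X, Y)) (n : ℕ) :
    ∀ φ ∈ coboundaries F Y n, pullbackCochain F g n φ ∈ coboundaries F X n := by
  intro φ hφ
  cases n with
  | zero =>
    rw [(Submodule.mem_bot F).1 hφ, map_zero]
    exact Submodule.zero_mem _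
  | succ n =>
    obtain ⟨η, rfl⟩ := hφ
    exact ⟨pullbackCochain F g n η, (pullbackCochain_coboundary F g n η).symm⟩

/-- The induced map `g* : Hⁿ(Y; F) → Hⁿ(X; F)`. -/
def pullbackH (g : C(X, Y)) (n : ℕ) : H F Y n →ₗ[F] H F X n :=
  Submodule.mapQ ((coboundaries F Y n).submoduleOf (cocycles F Y n))
    ((coboundaries F X n).submoduleOf (cocycles F X n))
    ((pullbackCochain F g n).restrict (pullback_mem_cocycles F g n))
    (fun φ hφ => pullback_mem_coboundaries F g n φ.1 hφ)

/-- The induced map `g* : H⋆(Y; F) → H⋆(X; F)`. -/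
def pullback (g : C(X, Y)) : Cohomology F Y →ₗ[F] Cohomology F X :=
  DirectSum.lmap (pullbackH F g)

theorem pullback_comp {Z : Type*} [TopologicalSpace Z] (g : C(X, Y)) (h : C(Y, Z))
    (a : Cohomology F Z) : pullback F (h.comp g) a = pullback F g (pullback F h a) := by
  refine DFinsupp.ext fun n => ?_
  change pullbackH F (h.comp g) n (a n) = pullbackH F g n (pullbackH F h n (a n))
  obtain ⟨φ, hφ⟩ := Submodule.Quotient.mk_surjective _ (a n)
  rw [← hφ]
  rfl

end Pullback

section Support

variable {F : Type*} [Field F] {X : Type*} [TopologicalSpace X]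

/-- The restriction of a class on `X` to a subset. -/
def restrictTo (O : Set X) : Cohomology F X →ₗ[F] Cohomology F O :=
  pullback F ⟨Subtype.val, continuous_subtype_val⟩

/-- `supp a ⊂ O`: there is an open set `O'` with `X = O ∪ O'` to which `a` restricts as zero. -/
def SupportedIn (a : Cohomology F X) (O : Set X) : Prop :=
  ∃ O' : Set X, IsOpen O' ∧ O ∪ O' = Set.univ ∧ restrictTo O' a = 0

theorem restrictTo_eq_zero_of_subset {U V : Set X} (h : V ⊆ U) {a : Cohomology F X}
    (ha : restrictTo U a = 0) : restrictTo V a = 0 := by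
  have := pullback_comp F (⟨Set.inclusion h, continuous_inclusion h⟩ : C(V, U))
    ⟨Subtype.val, continuous_subtype_val⟩ a
  exact this.trans ((congrArg _ ha).trans (map_zero _))

/-- The classes in `A` supported in `O`. -/
def supported (A : Submodule F (Cohomology F X)) (O : Set X) :
    Submodule F (Cohomology F X) where
  carrier := {a | a ∈ A ∧ SupportedIn a O}
  zero_mem' := ⟨A.zero_mem, Set.univ, isOpen_univ, Set.union_univ _, map_zero _⟩
  add_mem' := by
    rintro a b ⟨ha, U, hU, hOU, haU⟩ ⟨hb, V, hV, hOV, hbV⟩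
    refine ⟨A.add_mem ha hb, U ∩ V, hU.inter hV, ?_, ?_⟩
    · rw [Set.union_inter_distrib_left, hOU, hOV, Set.inter_self]
    · rw [map_add, restrictTo_eq_zero_of_subset Set.inter_subset_left haU,
        restrictTo_eq_zero_of_subset Set.inter_subset_right hbV, add_zero]
  smul_mem' := by
    rintro c a ⟨ha, U, hU, hOU, haU⟩
    exact ⟨A.smul_mem c ha, U, hU, hOU, by rw [map_smul, haU, smul_zero]⟩

/-- The classes in `A` supported in `O` all of whose nonzero pure components have their degree in
the open interval `(s, t)`. -/
def supportedDeg (A : Submodule F (Cohomology F X)) (O : Set X) (s t : ℝ) :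
    Submodule F (Cohomology F X) where
  carrier := {a | a ∈ supported A O ∧ ∀ n : ℕ, a n ≠ 0 → s < n ∧ (n : ℝ) < t}
  zero_mem' := ⟨Submodule.zero_mem _, fun n h => absurd rfl h⟩
  add_mem' := by
    rintro a b ⟨ha, ha'⟩ ⟨hb, hb'⟩
    refine ⟨Submodule.add_mem _ ha hb, fun n h => ?_⟩
    by_cases h0 : a n = 0
    · exact hb' n fun h1 => h (by rw [DirectSum.add_apply, h0, h1, add_zero])
    · exact ha' n h0
  smul_mem' := by
    rintro c a ⟨ha, ha'⟩
    refine ⟨Submodule.smul_mem _ c ha, fun n h => ha' n fun h0 => h ?_⟩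
    rw [DirectSum.smul_apply, h0, smul_zero]

/-- A subalgebra is graded if it contains the pure components of its elements. -/
def IsGraded (A : NonUnitalSubalgebra F (Cohomology F X)) : Prop :=
  ∀ a ∈ A, ∀ n, DirectSum.of (H F X) n (a n) ∈ A

/-- The map `A ⊗ B → H⋆(X; F)`, `a ⊗ b ↦ a ∧ b`. -/
def cupTensor (A B : NonUnitalSubalgebra F (Cohomology F X)) :
    A.toSubmodule ⊗[F] B.toSubmodule →ₗ[F] Cohomology F X :=
  TensorProduct.lift
    ((LinearMap.mul F (Cohomology F X)).domRestrict₁₂ A.toSubmodule B.toSubmodule)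

end Support

/-! ### Finite subsets of a group with a metric -/

section Metric

variable {Γ : Type*} [MetricSpace Γ]

/-- `d(Ω, Ω') = inf {d(γ, γ') ; γ ∈ Ω, γ' ∈ Ω'}`, equal to `∞` if one of the sets is empty. -/
def setDist (Ω Ω' : Set Γ) : ℝ≥0∞ := ⨅ γ ∈ Ω, ⨅ γ' ∈ Ω', edist γ γ'

/-- The `r`-boundary `{γ ; d(γ, Ω) ≤ r and d(γ, Γ - Ω) ≤ r}`. -/
def boundary (r : ℝ) (Ω : Finset Γ) : Set Γ :=
  {γ | setDist {γ} (Ω : Set Γ) ≤ ENNReal.ofReal r ∧ setDist {γ} (Ω : Set Γ)ᶜ ≤ ENNReal.ofReal r}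

open Classical in
/-- The `r`-interior `Ω - ∂_r Ω`. -/
def interior (r : ℝ) (Ω : Finset Γ) : Finset Γ := Ω.filter (· ∉ boundary r Ω)

end Metric

/-! ### Group actions and the homological measure -/

section Action

variable {Γ : Type*} [Group Γ] {X : Type*} [TopologicalSpace X] [MulAction Γ X]

/-- The average `f_Ω(x) = |Ω|⁻¹ ∑_{γ ∈ Ω} f₀(γ⁻¹ x)`. -/
def average (f₀ : X → ℝ) (Ω : Finset Γ) (x : X) : ℝ :=
  (∑ γ ∈ Ω, f₀ (γ⁻¹ • x)) / (Ω.card : ℝ)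

variable [ContinuousConstSMul Γ X] {F : Type*} [Field F]

/-- The left action `γ_* = (γ⁻¹)*` on cohomology. -/
def pushforward (γ : Γ) : Cohomology F X →ₗ[F] Cohomology F X :=
  pullback F ⟨fun x => γ⁻¹ • x, continuous_const_smul _⟩

/-- `A_Ω`, the (not necessarily unital) subalgebra generated by the translates `γ_* A`, `γ ∈ Ω`. -/
def genAlg (A : NonUnitalSubalgebra F (Cohomology F X)) (Ω : Finset Γ) :
    NonUnitalSubalgebra F (Cohomology F X) :=
  NonUnitalAlgebra.adjoin F (⋃ γ ∈ Ω, pushforward γ '' (A : Set (Cohomology F X)))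

/-- The action of `Γ` on `X` is product-like, as witnessed by the subalgebra `𝔞 ⊂ H⋆(X; F)` and the
numbers `N A`, for `A ⊂ 𝔞` a finite-dimensional (graded) subalgebra: `𝔞` contains a nonzero such
subalgebra, and the cup product `A_Ω ⊗ A_Ω' → A_{Ω ∪ Ω'}` is injective if `d(Ω, Ω') > N A`. -/
structure IsProductLike [MetricSpace Γ] (𝔞 : NonUnitalSubalgebra F (Cohomology F X))
    (N : NonUnitalSubalgebra F (Cohomology F X) → ℝ) : Prop where
  nontrivial : ∃ A : NonUnitalSubalgebra F (Cohomology F X),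
    A ≤ 𝔞 ∧ FiniteDimensional F A ∧ IsGraded A ∧ A ≠ ⊥
  nonneg : ∀ A : NonUnitalSubalgebra F (Cohomology F X),
    A ≤ 𝔞 → FiniteDimensional F A → IsGraded A → 0 ≤ N A
  injective : ∀ A : NonUnitalSubalgebra F (Cohomology F X),
    A ≤ 𝔞 → FiniteDimensional F A → IsGraded A →
      ∀ Ω Ω' : Finset Γ, ENNReal.ofReal (N A) < setDist (Ω : Set Γ) (Ω' : Set Γ) →
        Function.Injective (cupTensor (genAlg A Ω) (genAlg A Ω'))

/-- The map `φ(a)(b) = a ∧ b`, where `a` and `b` run over the classes of `B` supported in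
`f < c + δ`, resp. in `c - δ < f`, and `a` has degrees in `(s, t)`. The products lie in `B` and are
supported in `c - δ < f < c + δ`; the rank of `φ` is the same whether its values are regarded as
maps into the space of such classes or into `H⋆(X; F)`. -/
def cupMap (B : Submodule F (Cohomology F X)) (f : X → ℝ) (s t c δ : ℝ) :
    supportedDeg B (f ⁻¹' Set.Iio (c + δ)) s t →ₗ[F]
      (supported B (f ⁻¹' Set.Ioi (c - δ)) →ₗ[F] Cohomology F X) :=
  (LinearMap.mul F (Cohomology F X)).domRestrict₁₂ _ _

/-- The homological measure `b^{ℓ,ν}_{A,Ω}(c, δ)` of the thickened level `f_Ω⁻¹(c - δ, c + δ)`: the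
rank of `φ`, formed with the subalgebra `A_{int_r Ω}` and degrees in
`((ℓ - ν)|Ω|, (ℓ + ν)|Ω|)`. -/
def homologicalMeasure [MetricSpace Γ] (f₀ : X → ℝ)
    (A : NonUnitalSubalgebra F (Cohomology F X)) (r : ℝ) (Ω : Finset Γ) (ℓ ν c δ : ℝ) : Cardinal :=
  LinearMap.rank
    (cupMap (genAlg A (interior r Ω)).toSubmodule (average f₀ Ω)
      ((ℓ - ν) * (Ω.card : ℝ)) ((ℓ + ν) * (Ω.card : ℝ)) c δ)

end Action

end HomMeasure

end

/-!
The product `a ∧ a'` of classes `a ∈ A_{int Ω}` and `a' ∈ A_{int Ω'}` lies in `A_{int (Ω ∪ Ω')}`, its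
degrees are sums of degrees of `a` and `a'`, and since `f_{Ω ∪ Ω'}` is the convex combination of
`f_Ω` and `f_{Ω'}` with weights `α` and `1 - α` its support lies where it should, provided that
`supp (a ∧ a') ⊂ supp a ∩ supp a'`. The interiors are more than `N A` apart, because a point within
`r` of both would lie in `Ω` and in `Ω'`; hence `A_{int Ω} ⊗ A_{int Ω'}` embeds in the cohomology by
the cup product. By associativity and graded commutativity
`(a ∧ a') ∧ (b ∧ b') = ± (a ∧ b) ∧ (a' ∧ b')`, so the pairing for `Ω ∪ Ω'` restricts on products to
the tensor product of the pairings for `Ω` and `Ω'`, up to signs that do not affect independence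
when `a'` and `b` are pure (`rank_mul_rank_le`).

Two facts about singular cohomology carry this argument. If `a` vanishes on an open set `U` and `b`
on an open set `V` then `a ∧ b` vanishes on `U ∪ V` (`restrictTo_union_mul_eq_zero`): representing
cocycles can be chosen to vanish on the simplices inside `U`, respectively `V`, and then the product
vanishes on small simplices, hence is a coboundary (`mem_coboundaries_of_vanishesInside`). And the
cup product is graded commutative (`of_mul_of_comm`), because reversing the vertices of simplices,
with a sign, is homotopic to the identity.

Both use the same device. A singular cochain `φ` and a simplex `σ` of dimension `k` define a
function `w ↦ φ(σ ∘ [w])` of tuples `w` of points of the standard `k`-simplex, `[w]` being the affine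
simplex with vertices `w`. The complex of all functions of tuples is contracted by coning, so every
cochain map which is the identity on the empty tuple has a homotopy to the identity, constructed
recursively by coning from barycentres (`homotopyTo`); evaluated at the tuple of vertices, it gives
a homotopy of singular cochains when the map is natural (`sub_singularOp_mem_coboundaries`). Barycentric subdivision (`subdivide`) is defined by the same kind
of recursion, directly on cochains.
-/

noncomputable section

namespace HomMeasure

/-! ### Cochains on tuples of points -/

section TupleCochains

variable (F : Type*) [Field F] (V : Type*)

/-- Cochains on `n`-tuples of points of `V`: the augmented cochain complex of the full simplex with
vertex set `V`, indexed by the number of points (so the degree is `n - 1`). -/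
abbrev TupleCochain (n : ℕ) : Type _ := (Fin n → V) → F

variable {F V}

/-- The coboundary of tuple cochains. -/
def tupleD (n : ℕ) : TupleCochain F V n →ₗ[F] TupleCochain F V (n + 1) where
  toFun φ v := ∑ i : Fin (n + 1), (-1) ^ (i : ℕ) * φ (v ∘ i.succAbove)
  map_add' φ ψ := by
    funext v
    simp [mul_add, Finset.sum_add_distrib]
  map_smul' c φ := by
    funext v
    simp [Finset.mul_sum, mul_left_comm]

theorem tupleD_apply {n : ℕ} (φ : TupleCochain F V n) (v : Fin (n + 1) → V) :
    tupleD n φ v = ∑ i : Fin (n + 1), (-1) ^ (i : ℕ) * φ (v ∘ i.succAbove) := rfl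

/-- Evaluation on the cone with apex `b`: `(cone b φ)(v) = φ(b, v)`. -/
def cone (n : ℕ) (b : V) : TupleCochain F V (n + 1) →ₗ[F] TupleCochain F V n where
  toFun φ v := φ (Fin.cons b v)
  map_add' _ _ := rfl
  map_smul' _ _ := rfl

theorem cone_apply {n : ℕ} (b : V) (φ : TupleCochain F V (n + 1)) (v : Fin n → V) :
    cone n b φ v = φ (Fin.cons b v) := rfl

theorem cone_tupleD_zero (b : V) (φ : TupleCochain F V 0) : cone 0 b (tupleD 0 φ) = φ := by
  funext v
  rw [cone_apply, tupleD_apply]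
  simp [Subsingleton.elim _ v]

/-- Coning is a contracting homotopy of the augmented complex. -/
theorem cone_tupleD_succ {n : ℕ} (b : V) (φ : TupleCochain F V (n + 1)) :
    cone (n + 1) b (tupleD (n + 1) φ) = φ - tupleD n (cone n b φ) := by
  funext v
  rw [cone_apply, tupleD_apply, Fin.sum_univ_succ, Pi.sub_apply, tupleD_apply, sub_eq_add_neg,
    ← Finset.sum_neg_distrib]
  congr 1
  · simp only [Fin.val_zero, pow_zero, one_mul]
    congr 1
  · refine Finset.sum_congr rfl fun i _ => ?_
    have : (Fin.cons b v : Fin (n + 2) → V) ∘ i.succ.succAbove =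
        Fin.cons b (v ∘ i.succAbove) := by
      funext j
      refine Fin.cases ?_ (fun j => ?_) j <;> simp
    rw [this, cone_apply, Fin.val_succ, pow_succ]
    ring

theorem tupleD_tupleD {n : ℕ} (φ : TupleCochain F V n) : tupleD (n + 1) (tupleD n φ) = 0 := by
  -- Every tuple is a cone, and `cone b ∘ d ∘ d = d ∘ d ∘ cone b`.
  induction n with
  | zero =>
    funext v
    rw [← Fin.cons_self_tail v]
    change cone 1 (v 0) (tupleD 1 (tupleD 0 φ)) (Fin.tail v) = 0
    rw [cone_tupleD_succ, cone_tupleD_zero, sub_self]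
    rfl
  | succ n ih =>
    funext v
    rw [← Fin.cons_self_tail v]
    change cone _ (v 0) (tupleD _ (tupleD _ φ)) (Fin.tail v) = 0
    rw [cone_tupleD_succ, cone_tupleD_succ, map_sub, ih, sub_zero, sub_self]
    rfl

/-- The pullback of tuple cochains along a map of point sets. -/
def tuplePull {W : Type*} (f : V → W) (n : ℕ) :
    TupleCochain F W n →ₗ[F] TupleCochain F V n where
  toFun φ v := φ (f ∘ v)
  map_add' _ _ := rfl
  map_smul' _ _ := rfl

theorem tuplePull_apply {W : Type*} (f : V → W) {n : ℕ} (φ : TupleCochain F W n) (v : Fin n → V) :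
    tuplePull f n φ v = φ (f ∘ v) := rfl

theorem cone_tuplePull {W : Type*} (f : V → W) {n : ℕ} (b : V) (φ : TupleCochain F W (n + 1)) :
    cone n b (tuplePull f (n + 1) φ) = tuplePull f n (cone n (f b) φ) := by
  funext v
  simp only [cone_apply, tuplePull_apply]
  congr 1
  funext j
  refine Fin.cases ?_ (fun j => ?_) j <;> simp

theorem tupleD_tuplePull {W : Type*} (f : V → W) {n : ℕ} (φ : TupleCochain F W n) :
    tupleD n (tuplePull f n φ) = tuplePull f (n + 1) (tupleD n φ) := rfl

/-! ### Homotopies and barycentric subdivision of tuple cochains -/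

/-- The homotopy between the identity and a cochain map `R`, built degree by degree by coning the
defect `id - R - d T` from a point `β v` chosen for each tuple `v`. -/
def homotopyTo (β : ∀ n, (Fin (n + 1) → V) → V)
    (R : ∀ n, TupleCochain F V n →ₗ[F] TupleCochain F V n) :
    ∀ n, TupleCochain F V (n + 1) →ₗ[F] TupleCochain F V n
  | 0 => 0
  | n + 1 => LinearMap.pi fun v => LinearMap.proj v ∘ₗ
      (LinearMap.id - R (n + 1) - tupleD n ∘ₗ homotopyTo β R n) ∘ₗ cone (n + 1) (β n v)

theorem homotopyTo_succ_apply (β : ∀ n, (Fin (n + 1) → V) → V)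
    (R : ∀ n, TupleCochain F V n →ₗ[F] TupleCochain F V n) {n : ℕ}
    (φ : TupleCochain F V (n + 2)) (v : Fin (n + 1) → V) :
    homotopyTo β R (n + 1) φ v =
      cone (n + 1) (β n v) φ v - R (n + 1) (cone (n + 1) (β n v) φ) v -
        tupleD n (homotopyTo β R n (cone (n + 1) (β n v) φ)) v := rfl

/-- The homotopy identity `T d + d T = id - R`. -/
theorem homotopyTo_tupleD (β : ∀ n, (Fin (n + 1) → V) → V)
    (R : ∀ n, TupleCochain F V n →ₗ[F] TupleCochain F V n) (hR0 : R 0 = LinearMap.id)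
    (hRd : ∀ n (φ : TupleCochain F V n), R (n + 1) (tupleD n φ) = tupleD n (R n φ)) {n : ℕ}
    (φ : TupleCochain F V (n + 1)) :
    homotopyTo β R (n + 1) (tupleD (n + 1) φ) + tupleD n (homotopyTo β R n φ) =
      φ - R (n + 1) φ := by
  have h0 : ∀ φ : TupleCochain F V 0, homotopyTo β R 0 (tupleD 0 φ) = φ - R 0 φ := by
    intro φ
    rw [hR0]
    simp [homotopyTo]
  -- The correction terms cancel as soon as `d T d = d (id - R)` holds one degree lower.
  have key : ∀ {n : ℕ}, (∀ ψ : TupleCochain F V n,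
      tupleD n (homotopyTo β R n (tupleD n ψ)) = tupleD n (ψ - R n ψ)) →
      ∀ φ : TupleCochain F V (n + 1),
        homotopyTo β R (n + 1) (tupleD (n + 1) φ) + tupleD n (homotopyTo β R n φ) =
          φ - R (n + 1) φ := by
    intro n ih φ
    funext v
    rw [Pi.add_apply, homotopyTo_succ_apply, cone_tupleD_succ, map_sub, map_sub, map_sub, ih,
      hRd, map_sub]
    simp only [Pi.sub_apply]
    ring
  induction n with
  | zero => exact key (fun ψ => by rw [h0]) φ
  | succ n ih =>
    refine key (fun ψ => ?_) φ
    rw [← ih, map_add, tupleD_tupleD, add_zero]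

theorem homotopyTo_tuplePull {W : Type*} (f : V → W) (β : ∀ n, (Fin (n + 1) → V) → V)
    (β' : ∀ n, (Fin (n + 1) → W) → W) (hβ : ∀ n v, f (β n v) = β' n (f ∘ v))
    (R : ∀ n, TupleCochain F V n →ₗ[F] TupleCochain F V n)
    (R' : ∀ n, TupleCochain F W n →ₗ[F] TupleCochain F W n)
    (hR : ∀ n φ, R n (tuplePull f n φ) = tuplePull f n (R' n φ)) {n : ℕ}
    (φ : TupleCochain F W (n + 1)) :
    homotopyTo β R n (tuplePull f (n + 1) φ) = tuplePull f n (homotopyTo β' R' n φ) := by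
  induction n with
  | zero => rfl
  | succ n ih =>
    funext v
    rw [tuplePull_apply, homotopyTo_succ_apply, homotopyTo_succ_apply, cone_tuplePull, ih, hR,
      hβ, tupleD_tuplePull]
    rfl

/-- Barycentric subdivision of tuple cochains, dual to `S v = β(v) * S(∂v)`, where `β v` plays the
part of the barycentre of `v`. -/
def subdivide (β : ∀ n, (Fin (n + 1) → V) → V) :
    ∀ n, TupleCochain F V n →ₗ[F] TupleCochain F V n
  | 0 => LinearMap.id
  | n + 1 => LinearMap.pi fun v => LinearMap.proj v ∘ₗ tupleD n ∘ₗ subdivide β n ∘ₗ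
      cone n (β n v)

theorem subdivide_succ_apply (β : ∀ n, (Fin (n + 1) → V) → V) {n : ℕ}
    (φ : TupleCochain F V (n + 1)) (v : Fin (n + 1) → V) :
    subdivide β (n + 1) φ v = tupleD n (subdivide β n (cone n (β n v) φ)) v := rfl

theorem subdivide_tupleD (β : ∀ n, (Fin (n + 1) → V) → V) (n : ℕ) (φ : TupleCochain F V n) :
    subdivide β (n + 1) (tupleD n φ) = tupleD n (subdivide β n φ) := by
  induction n with
  | zero =>
    funext v
    rw [subdivide_succ_apply, cone_tupleD_zero]
  | succ n ih =>
    funext v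
    rw [subdivide_succ_apply, cone_tupleD_succ, map_sub, map_sub, ih, tupleD_tupleD, sub_zero]

theorem subdivide_tuplePull {W : Type*} (f : V → W) (β : ∀ n, (Fin (n + 1) → V) → V)
    (β' : ∀ n, (Fin (n + 1) → W) → W) (hβ : ∀ n v, f (β n v) = β' n (f ∘ v)) (n : ℕ)
    (φ : TupleCochain F W n) :
    subdivide β n (tuplePull f n φ) = tuplePull f n (subdivide β' n φ) := by
  induction n with
  | zero => rfl
  | succ n ih =>
    funext v
    rw [tuplePull_apply, subdivide_succ_apply, subdivide_succ_apply, cone_tuplePull, ih,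
      tupleD_tuplePull, hβ]
    rfl

/-- A set of points containing `β v` as soon as it contains the points of `v`. -/
def ClosedUnder (β : ∀ n, (Fin (n + 1) → V) → V) (C : Set V) : Prop :=
  ∀ n v, (∀ i, v i ∈ C) → β n v ∈ C

/-- The cochain vanishes on the tuples of points of `C`. -/
def VanishesOn {n : ℕ} (φ : TupleCochain F V n) (C : Set V) : Prop :=
  ∀ v, (∀ i, v i ∈ C) → φ v = 0

theorem VanishesOn.tupleD {n : ℕ} {φ : TupleCochain F V n} {C : Set V} (h : VanishesOn φ C) :
    VanishesOn (tupleD n φ) C := fun v hv => by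
  rw [tupleD_apply]
  exact Finset.sum_eq_zero fun i _ => by rw [h (v ∘ i.succAbove) fun j => hv _, mul_zero]

theorem VanishesOn.cone {n : ℕ} {φ : TupleCochain F V (n + 1)} {C : Set V} (h : VanishesOn φ C)
    {b : V} (hb : b ∈ C) : VanishesOn (cone n b φ) C := fun v hv =>
  h _ fun i => Fin.cases hb (fun j => by simpa using hv j) i

theorem VanishesOn.subdivide {β : ∀ n, (Fin (n + 1) → V) → V} {C : Set V}
    (hC : ClosedUnder β C) {n : ℕ} {φ : TupleCochain F V n} (h : VanishesOn φ C) :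
    VanishesOn (subdivide β n φ) C := by
  induction n with
  | zero => exact h
  | succ n ih => exact fun v hv => (ih (h.cone (hC n v hv))).tupleD v hv

theorem VanishesOn.homotopyTo {β : ∀ n, (Fin (n + 1) → V) → V}
    {R : ∀ n, TupleCochain F V n →ₗ[F] TupleCochain F V n} {C : Set V} (hC : ClosedUnder β C)
    (hR : ∀ n (φ : TupleCochain F V n), VanishesOn φ C → VanishesOn (R n φ) C)
    {n : ℕ} {φ : TupleCochain F V (n + 1)} (h : VanishesOn φ C) :
    VanishesOn (homotopyTo β R n φ) C := by
  induction n with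
  | zero => exact fun _ _ => rfl
  | succ n ih =>
    intro v hv
    have hc := h.cone (hC n v hv)
    rw [homotopyTo_succ_apply, hc v hv, hR _ _ hc v hv, (ih hc).tupleD v hv, sub_zero, sub_zero]

/-- One subdivision shrinks diameters by the factor `q`: if `φ` vanishes on the tuples of
diameter at most `q * d` then its subdivision vanishes on the tuples of diameter at most `d`. The
set `C` records, through the induction, the balls around the barycentres of the faces already
coned off. -/
theorem subdivide_apply_eq_zero [PseudoMetricSpace V] (β : ∀ n, (Fin (n + 1) → V) → V)
    (hball : ∀ (x : V) (R : ℝ), ClosedUnder β (Metric.closedBall x R)) {q d : ℝ} {m : ℕ}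
    (hβ : ∀ n, n < m → ∀ v : Fin (n + 1) → V, (∀ i j, dist (v i) (v j) ≤ d) →
      ∀ j, dist (v j) (β n v) ≤ q * d) (hqd : 0 ≤ q * d)
    {n : ℕ} (hn : n ≤ m) (C : Set V) (hC : ClosedUnder β C) (φ : TupleCochain F V n)
    (hφ : ∀ w, (∀ i, w i ∈ C) → (∀ i j, dist (w i) (w j) ≤ q * d) → φ w = 0)
    (v : Fin n → V) (hvC : ∀ i, v i ∈ C) (hv : ∀ i j, dist (v i) (v j) ≤ d) :
    subdivide β n φ v = 0 := by
  induction n generalizing C with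
  | zero => exact hφ v hvC fun i => i.elim0
  | succ n ih =>
    rw [subdivide_succ_apply, tupleD_apply]
    refine Finset.sum_eq_zero fun i _ => ?_
    rw [ih (by omega) (C ∩ Metric.closedBall (β n v) (q * d))
      (fun k w hw => ⟨hC k w fun i => (hw i).1, hball _ _ k w fun i => (hw i).2⟩), mul_zero]
    · intro w hwC hw
      refine hφ _ (fun i => ?_) (fun i j => ?_)
      · refine Fin.cases ?_ (fun j => ?_) i
        · exact hC n v hvC
        · simpa using (hwC j).1
      · refine Fin.cases ?_ (fun i => ?_) i <;> refine Fin.cases ?_ (fun j => ?_) j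
        · simpa using hqd
        · simpa [dist_comm] using (hwC j).2
        · simpa using (hwC i).2
        · simpa using hw i j
    · exact fun j => ⟨hvC _, hβ n (by omega) v hv _⟩
    · exact fun j k => hv _ _

/-- After `m` subdivisions only tuples of diameter at most `q ^ m * d` matter. -/
theorem subdivide_pow_apply_eq_zero [PseudoMetricSpace V] (β : ∀ n, (Fin (n + 1) → V) → V)
    (hball : ∀ (x : V) (R : ℝ), ClosedUnder β (Metric.closedBall x R)) {q : ℝ} {n : ℕ}
    (hq : 0 ≤ q)
    (hβ : ∀ k, k < n → ∀ (v : Fin (k + 1) → V) (d : ℝ), (∀ i j, dist (v i) (v j) ≤ d) →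
      ∀ j, dist (v j) (β k v) ≤ q * d)
    {d : ℝ} (hd : 0 ≤ d) (m : ℕ) (φ : TupleCochain F V n)
    (hφ : ∀ w, (∀ i j, dist (w i) (w j) ≤ q ^ m * d) → φ w = 0)
    (v : Fin n → V) (hv : ∀ i j, dist (v i) (v j) ≤ d) :
    (subdivide β n ^ m) φ v = 0 := by
  induction m generalizing φ with
  | zero => exact hφ v (by simpa using hv)
  | succ m ih =>
    rw [pow_succ, Module.End.mul_apply]
    refine ih _ fun w hw => ?_
    refine subdivide_apply_eq_zero β hball (fun k hk v hv => hβ k hk v _ hv) (by positivity) le_rfl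
      Set.univ (fun _ _ _ => trivial) φ (fun u _ hu => hφ u fun i j => ?_) w (fun _ => trivial) hw
    rw [pow_succ', mul_assoc]
    exact hu i j

end TupleCochains

/-! ### Affine simplices in standard simplices -/

section Affine

/-- The point `∑ᵢ tᵢ wᵢ` of a standard simplex. -/
def convexComb {n k : ℕ} (w : Fin (n + 1) → stdSimplex ℝ (Fin (k + 1)))
    (t : stdSimplex ℝ (Fin (n + 1))) : stdSimplex ℝ (Fin (k + 1)) :=
  ⟨∑ i, t i • (w i : Fin (k + 1) → ℝ), (convex_stdSimplex ℝ (Fin (k + 1))).sum_mem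
    (fun i _ => t.2.1 i) t.2.2 fun i _ => (w i).2⟩

theorem convexComb_coe {n k : ℕ} (w : Fin (n + 1) → stdSimplex ℝ (Fin (k + 1)))
    (t : stdSimplex ℝ (Fin (n + 1))) :
    (convexComb w t : Fin (k + 1) → ℝ) = ∑ i, t i • (w i : Fin (k + 1) → ℝ) := rfl

theorem map_convexComb {n k l : ℕ} (f : Fin (k + 1) → Fin (l + 1))
    (w : Fin (n + 1) → stdSimplex ℝ (Fin (k + 1))) (t : stdSimplex ℝ (Fin (n + 1))) :
    stdSimplex.map f (convexComb w t) = convexComb (stdSimplex.map f ∘ w) t := by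
  ext j
  simp only [convexComb_coe, stdSimplex.map_coe, Function.comp_apply, map_sum, map_smul]

theorem convexComb_map {n m k : ℕ} (w : Fin (n + 1) → stdSimplex ℝ (Fin (k + 1)))
    (f : Fin (m + 1) → Fin (n + 1)) (t : stdSimplex ℝ (Fin (m + 1))) :
    convexComb w (stdSimplex.map f t) = convexComb (w ∘ f) t := by
  ext j
  have h : ∀ i, stdSimplex.map f t i = ∑ a with f a = i, t a := fun i =>
    (congrFun (stdSimplex.map_coe f t) i).trans (FunOnFinite.linearMap_apply_apply ..)
  simp only [convexComb_coe, h, Finset.sum_apply, Pi.smul_apply, smul_eq_mul, Finset.sum_mul,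
    Function.comp_apply]
  rw [← Finset.sum_fiberwise (s := Finset.univ) (g := f)]
  exact Finset.sum_congr rfl fun i _ => Finset.sum_congr rfl fun a ha => by
    rw [(Finset.mem_filter.1 ha).2]

theorem convexComb_vertex {n : ℕ} (t : stdSimplex ℝ (Fin (n + 1))) :
    convexComb stdSimplex.vertex t = t := by
  ext j
  simp [convexComb_coe, Pi.single_apply]

/-- The affine singular simplex with vertices `w`. -/
def affineSimplex {n k : ℕ} (w : Fin (n + 1) → stdSimplex ℝ (Fin (k + 1))) :
    Simplex (stdSimplex ℝ (Fin (k + 1))) n where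
  toFun := convexComb w
  continuous_toFun := by
    refine Continuous.subtype_mk (continuous_finsetSum _ fun i _ => ?_) _
    exact ((continuous_apply i).comp continuous_subtype_val).smul continuous_const

theorem affineSimplex_apply {n k : ℕ} (w : Fin (n + 1) → stdSimplex ℝ (Fin (k + 1)))
    (t : stdSimplex ℝ (Fin (n + 1))) : affineSimplex w t = convexComb w t := rfl

/-- The barycentre of a tuple of points of a standard simplex. -/
def bary (k n : ℕ) (w : Fin (n + 1) → stdSimplex ℝ (Fin (k + 1))) : stdSimplex ℝ (Fin (k + 1)) :=
  convexComb w stdSimplex.barycenter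

theorem map_bary {k l : ℕ} (f : Fin (k + 1) → Fin (l + 1)) (n : ℕ)
    (w : Fin (n + 1) → stdSimplex ℝ (Fin (k + 1))) :
    stdSimplex.map f (bary k n w) = bary l n (stdSimplex.map f ∘ w) :=
  map_convexComb f w _

theorem convexComb_mem_closedBall {n k : ℕ} {w : Fin (n + 1) → stdSimplex ℝ (Fin (k + 1))}
    {x : stdSimplex ℝ (Fin (k + 1))} {R : ℝ} (hw : ∀ i, w i ∈ Metric.closedBall x R)
    (t : stdSimplex ℝ (Fin (n + 1))) : convexComb w t ∈ Metric.closedBall x R :=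
  (convex_closedBall (x : Fin (k + 1) → ℝ) R).sum_mem (fun i _ => t.2.1 i) t.2.2 fun i _ => hw i

theorem closedUnder_bary_closedBall {k : ℕ} (x : stdSimplex ℝ (Fin (k + 1))) (R : ℝ) :
    ClosedUnder (bary k) (Metric.closedBall x R) := fun _ _ hv =>
  convexComb_mem_closedBall hv _

/-- The barycentre of `n + 1` points at mutual distance at most `d` is at distance at most
`n / (n + 1) * d` from each of them. -/
theorem dist_bary_le {k n : ℕ} (v : Fin (n + 1) → stdSimplex ℝ (Fin (k + 1))) {d : ℝ}
    (hv : ∀ i j, dist (v i) (v j) ≤ d) (j : Fin (n + 1)) :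
    dist (v j) (bary k n v) ≤ (n / (n + 1) : ℝ) * d := by
  have hn : (0 : ℝ) < n + 1 := by positivity
  have hb : ∀ i, (stdSimplex.barycenter : stdSimplex ℝ (Fin (n + 1))) i = (n + 1 : ℝ)⁻¹ :=
    fun i => by
      change ((Fintype.card (Fin (n + 1)) : ℝ))⁻¹ = _
      simp
  have e : (bary k n v).1 - (v j).1 =
      ∑ i ∈ Finset.univ.erase j, ((n + 1 : ℝ)⁻¹) • ((v i).1 - (v j).1) := by
    rw [Finset.sum_erase _ (by rw [sub_self, smul_zero]), ← Finset.smul_sum,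
      Finset.sum_sub_distrib, smul_sub, Finset.sum_const, Finset.card_univ,
      Fintype.card_fin, Finset.smul_sum, ← Nat.cast_smul_eq_nsmul ℝ, smul_smul]
    congr 1
    · change ∑ i, (stdSimplex.barycenter : stdSimplex ℝ (Fin (n + 1))) i • (v i).1 = _
      exact Finset.sum_congr rfl fun i _ => by rw [hb]
    · push_cast
      rw [inv_mul_cancel₀ hn.ne', one_smul]
  rw [dist_comm, Subtype.dist_eq, dist_eq_norm, e]
  calc _ ≤ ∑ i ∈ Finset.univ.erase j, (n + 1 : ℝ)⁻¹ * d := by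
        refine norm_sum_le_of_le _ fun i _ => ?_
        rw [norm_smul, Real.norm_of_nonneg (by positivity), ← dist_eq_norm, ← Subtype.dist_eq]
        exact mul_le_mul_of_nonneg_left (hv i j) (by positivity)
    _ = (n / (n + 1) : ℝ) * d := by
        rw [Finset.sum_const, Finset.card_erase_of_mem (Finset.mem_univ _), Finset.card_univ,
          Fintype.card_fin, nsmul_eq_mul]
        simp only [Nat.add_sub_cancel]
        ring

end Affine

/-! ### Singular cochains as tuple cochains on standard simplices -/

section Singular

variable {F : Type*} {X : Type*} [TopologicalSpace X]

/-- The tuple cochain `w ↦ φ(σ ∘ [w])` on the standard simplex obtained from a singular cochain `φ`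
and a singular simplex `σ`. -/
def tupleEval {k : ℕ} (σ : Simplex X k) {n : ℕ} (φ : Cochain F X n) :
    TupleCochain F (stdSimplex ℝ (Fin (k + 1))) (n + 1) :=
  fun w => φ (σ.comp (affineSimplex w))

theorem tupleEval_vertex_comp {k n : ℕ} (σ : Simplex X k) (f : Fin (n + 1) → Fin (k + 1))
    (φ : Cochain F X n) : tupleEval σ φ (stdSimplex.vertex ∘ f) = φ (σ.res f) := by
  refine congrArg φ ?_
  ext t
  refine congrArg σ ?_
  rw [affineSimplex_apply, ← convexComb_map, convexComb_vertex]
  rfl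

theorem tupleEval_vertex {n : ℕ} (σ : Simplex X n) (φ : Cochain F X n) :
    tupleEval σ φ stdSimplex.vertex = φ σ := by
  refine congrArg φ ?_
  ext t
  exact congrArg σ (convexComb_vertex t)

variable [Field F]

theorem tupleEval_coboundary {k : ℕ} (σ : Simplex X k) {n : ℕ} (φ : Cochain F X n) :
    tupleEval σ (coboundary n φ) = tupleD (n + 1) (tupleEval σ φ) := by
  funext w
  change ∑ i : Fin (n + 2), _ = ∑ i : Fin (n + 2), _
  refine Finset.sum_congr rfl fun i _ => ?_
  congr 2
  ext t
  exact congrArg σ (convexComb_map w i.succAbove t)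

theorem tupleEval_res {k l : ℕ} (σ : Simplex X k) (f : Fin (l + 1) → Fin (k + 1)) {n : ℕ}
    (φ : Cochain F X n) :
    tupleEval (σ.res f) φ = tuplePull (stdSimplex.map f) (n + 1) (tupleEval σ φ) := by
  funext w
  refine congrArg φ ?_
  ext t
  exact congrArg σ (map_convexComb f w t)

/-- The singular cochain `σ ↦ (P φ^σ)(e₀, …, e_n)` obtained from an operator `P` on tuple cochains
on standard simplices. -/
def singularOp {m n : ℕ}
    (P : ∀ k, TupleCochain F (stdSimplex ℝ (Fin (k + 1))) (m + 1) →
      TupleCochain F (stdSimplex ℝ (Fin (k + 1))) (n + 1)) (φ : Cochain F X m) :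
    Cochain F X n :=
  fun σ => P n (tupleEval σ φ) stdSimplex.vertex

/-- A natural operator on tuple cochains commutes with the passage to faces. -/
theorem coboundary_singularOp {m n : ℕ}
    (P : ∀ k, TupleCochain F (stdSimplex ℝ (Fin (k + 1))) (m + 1) →
      TupleCochain F (stdSimplex ℝ (Fin (k + 1))) (n + 1))
    (hP : ∀ {k l : ℕ} (f : Fin (k + 1) → Fin (l + 1)) φ,
      P k (tuplePull (stdSimplex.map f) _ φ) = tuplePull (stdSimplex.map f) _ (P l φ))
    (φ : Cochain F X m) (σ : Simplex X (n + 1)) :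
    coboundary n (singularOp P φ) σ =
      tupleD (n + 1) (P (n + 1) (tupleEval σ φ)) stdSimplex.vertex := by
  rw [coboundary_apply, tupleD_apply]
  refine Finset.sum_congr rfl fun i _ => ?_
  rw [singularOp, tupleEval_res, hP, tuplePull_apply]
  congr 2
  funext j
  exact stdSimplex.map_vertex _ _

/-- The homotopy identity for singular cochains: a natural cochain map of tuple cochains on standard
simplices moves singular cocycles by coboundaries only. -/
theorem sub_singularOp_mem_coboundaries
    (R : ∀ k n, TupleCochain F (stdSimplex ℝ (Fin (k + 1))) n →ₗ[F]
      TupleCochain F (stdSimplex ℝ (Fin (k + 1))) n)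
    (hR0 : ∀ k, R k 0 = LinearMap.id)
    (hRd : ∀ k n φ, R k (n + 1) (tupleD n φ) = tupleD n (R k n φ))
    (hR : ∀ {k l : ℕ} (f : Fin (k + 1) → Fin (l + 1)) n φ,
      R k n (tuplePull (stdSimplex.map f) _ φ) = tuplePull (stdSimplex.map f) _ (R l n φ))
    {n : ℕ} {φ : Cochain F X n} (hφ : φ ∈ cocycles F X n) :
    φ - singularOp (fun k => R k (n + 1)) φ ∈ coboundaries F X n := by
  have hd : ∀ (σ : Simplex X n), tupleD (n + 1) (tupleEval σ φ) = 0 := by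
    intro σ
    rw [← tupleEval_coboundary, LinearMap.mem_ker.1 hφ]
    rfl
  have key : ∀ σ : Simplex X n,
      tupleD n (homotopyTo (bary n) (R n) n (tupleEval σ φ)) stdSimplex.vertex =
        φ σ - singularOp (fun k => R k (n + 1)) φ σ := by
    intro σ
    have := congrFun (homotopyTo_tupleD (bary n) (R n) (hR0 n) (hRd n) (tupleEval σ φ))
      stdSimplex.vertex
    rw [hd, map_zero, zero_add, Pi.sub_apply, tupleEval_vertex] at this
    exact this
  cases n with
  | zero =>
    refine (Submodule.mem_bot F).2 (funext fun σ => ?_)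
    rw [Pi.sub_apply, ← key σ]
    rw [tupleD_apply]
    exact Finset.sum_eq_zero fun i _ => mul_zero ((-1 : F) ^ (i : ℕ))
  | succ n =>
    refine ⟨singularOp (fun k => homotopyTo (bary k) (R k) (n + 1)) φ, funext fun σ => ?_⟩
    rw [coboundary_singularOp, key σ]
    · rfl
    · intro k l f ψ
      exact homotopyTo_tuplePull _ _ _ (fun n v => map_bary f n v) _ _ (fun n ψ => hR f n ψ) ψ

end Singular

/-! ### Small simplices -/

section Small

variable {F : Type*} [Field F] {X : Type*} [TopologicalSpace X]

/-- The cochain vanishes on the singular simplices with image in `U`. -/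
def VanishesInside {n : ℕ} (φ : Cochain F X n) (U : Set X) : Prop :=
  ∀ σ : Simplex X n, (∀ t, σ t ∈ U) → φ σ = 0

/-- After sufficiently many subdivisions only simplices inside `U` or inside `V` occur. -/
theorem exists_subdivide_pow_eq_zero {U V : Set X} (hU : IsOpen U) (hV : IsOpen V)
    (hUV : U ∪ V = Set.univ) {k : ℕ} (σ : Simplex X k) {n : ℕ}
    (φ : TupleCochain F (stdSimplex ℝ (Fin (k + 1))) n)
    (hφ : ∀ (x : stdSimplex ℝ (Fin (k + 1))) (R : ℝ),
      (Metric.closedBall x R ⊆ σ ⁻¹' U ∨ Metric.closedBall x R ⊆ σ ⁻¹' V) →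
        VanishesOn φ (Metric.closedBall x R))
    (v : Fin n → stdSimplex ℝ (Fin (k + 1))) :
    ∃ m₀, ∀ m, m₀ ≤ m → (subdivide (bary k) n ^ m) φ v = 0 := by
  obtain ⟨ε, hε, hball⟩ := lebesgue_number_lemma_of_metric
    (s := (Set.univ : Set (stdSimplex ℝ (Fin (k + 1))))) (c := fun b : Bool => σ ⁻¹' (cond b U V))
    isCompact_univ (by rintro (_ | _); exacts [hV.preimage σ.continuous, hU.preimage σ.continuous])
    (fun x _ => by
      rcases (hUV ▸ Set.mem_univ (σ x) : σ x ∈ U ∪ V) with h | h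
      exacts [Set.mem_iUnion.2 ⟨true, h⟩, Set.mem_iUnion.2 ⟨false, h⟩])
  have hdiam : ∀ x y : stdSimplex ℝ (Fin (k + 1)), dist x y ≤ 1 := fun x y =>
    (Metric.dist_le_diam_of_mem (bounded_stdSimplex _) x.2 y.2).trans diam_stdSimplex_le
  have hn : (0 : ℝ) < n + 1 := by positivity
  have hq : 0 ≤ (n / (n + 1) : ℝ) := by positivity
  have hq1 : (n / (n + 1) : ℝ) < 1 := (div_lt_one hn).2 (by linarith)
  obtain ⟨m₀, hm₀⟩ := exists_pow_lt_of_lt_one hε hq1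
  refine ⟨m₀, fun m hm => ?_⟩
  refine subdivide_pow_apply_eq_zero (bary k) closedUnder_bary_closedBall hq ?_ zero_le_one m φ
    ?_ v fun i j => hdiam _ _
  · intro l hl w d hw j
    refine (dist_bary_le w hw j).trans (mul_le_mul_of_nonneg_right ?_
      (dist_nonneg.trans (hw j j)))
    rw [div_le_div_iff₀ (by positivity) hn]
    have : (l : ℝ) ≤ n := by exact_mod_cast hl.le
    nlinarith
  · intro w hw
    rw [mul_one] at hw
    have hlt := (pow_le_pow_of_le_one hq hq1.le hm).trans_lt hm₀
    -- The empty tuple still needs a centre for its ball.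
    obtain ⟨x, hx⟩ : ∃ x, ∀ i, dist (w i) x ≤ (n / (n + 1) : ℝ) ^ m := by
      cases n with
      | zero => exact ⟨stdSimplex.vertex 0, fun i => i.elim0⟩
      | succ n => exact ⟨w 0, fun i => hw i 0⟩
    obtain ⟨b, hb⟩ := hball x trivial
    have hb' := (Metric.closedBall_subset_ball hlt).trans hb
    refine hφ x _ ?_ w hx
    cases b
    exacts [Or.inr hb', Or.inl hb']

/-- The theorem of small simplices: a cocycle which vanishes on the simplices inside one of the two
members of an open cover is a coboundary. It bounds the cochain `∑ᵢ ζ ∘ T ∘ Sⁱ`, where `S` is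
the subdivision and `T` the homotopy from the identity to `S`; the sum is finite on each simplex. -/
theorem mem_coboundaries_of_vanishesInside {U V : Set X} (hU : IsOpen U) (hV : IsOpen V)
    (hUV : U ∪ V = Set.univ) {n : ℕ} {ζ : Cochain F X n} (hζ : ζ ∈ cocycles F X n)
    (hζU : VanishesInside ζ U) (hζV : VanishesInside ζ V) : ζ ∈ coboundaries F X n := by
  have hball : ∀ {k : ℕ} (σ : Simplex X k) (x : stdSimplex ℝ (Fin (k + 1))) (R : ℝ),
      (Metric.closedBall x R ⊆ σ ⁻¹' U ∨ Metric.closedBall x R ⊆ σ ⁻¹' V) →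
        VanishesOn (tupleEval σ ζ) (Metric.closedBall x R) := by
    intro k σ x R h w hw
    rcases h with h | h
    exacts [hζU _ fun t => h (convexComb_mem_closedBall hw t),
      hζV _ fun t => h (convexComb_mem_closedBall hw t)]
  cases n with
  | zero =>
    -- A `0`-simplex is a point, hence small.
    refine (Submodule.mem_bot F).2 (funext fun σ => ?_)
    rcases (hUV ▸ Set.mem_univ (σ default) : σ default ∈ U ∪ V) with h | h
    exacts [hζU σ fun t => Subsingleton.elim default t ▸ h,
      hζV σ fun t => Subsingleton.elim default t ▸ h]
  | succ n =>
    let T : ∀ k, TupleCochain F (stdSimplex ℝ (Fin (k + 1))) (n + 2) →ₗ[F]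
        TupleCochain F (stdSimplex ℝ (Fin (k + 1))) (n + 1) := fun k =>
      homotopyTo (bary k) (subdivide (bary k)) (n + 1)
    let P : ∀ (m k : ℕ), TupleCochain F (stdSimplex ℝ (Fin (k + 1))) (n + 2) →
        TupleCochain F (stdSimplex ℝ (Fin (k + 1))) (n + 1) := fun m k φ =>
      (subdivide (bary k) (n + 1) ^ m) (T k φ)
    have hPnat : ∀ (m : ℕ) {k l : ℕ} (f : Fin (k + 1) → Fin (l + 1)) φ,
        P m k (tuplePull (stdSimplex.map f) _ φ) = tuplePull (stdSimplex.map f) _ (P m l φ) := by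
      intro m k l f φ
      induction m with
      | zero =>
        exact homotopyTo_tuplePull _ _ _ (fun n v => map_bary f n v) _ _
          (subdivide_tuplePull _ _ _ fun n v => map_bary f n v) φ
      | succ m ih =>
        simp only [P, pow_succ', Module.End.mul_apply] at ih ⊢
        rw [ih, subdivide_tuplePull _ _ (bary l) fun n v => map_bary f n v]
    have hsmall : ∀ {k : ℕ} (σ : Simplex X k) v, ∃ m₀, ∀ m, m₀ ≤ m →
        P m k (tupleEval σ ζ) v = 0 := fun σ v =>
      exists_subdivide_pow_eq_zero hU hV hUV σ _ (fun x R h =>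
        (hball σ x R h).homotopyTo (closedUnder_bary_closedBall x R)
          fun _ _ h => h.subdivide (closedUnder_bary_closedBall x R)) v
    have hstep : ∀ (m : ℕ) {k : ℕ} (σ : Simplex X k),
        tupleD (n + 1) (P m k (tupleEval σ ζ)) =
          (subdivide (bary k) (n + 2) ^ m) (tupleEval σ ζ) -
            (subdivide (bary k) (n + 2) ^ (m + 1)) (tupleEval σ ζ) := by
      intro m k σ
      have hcomm : ∀ (m : ℕ) (φ : TupleCochain F (stdSimplex ℝ (Fin (k + 1))) (n + 1)),
          tupleD (n + 1) ((subdivide (bary k) (n + 1) ^ m) φ) =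
            (subdivide (bary k) (n + 2) ^ m) (tupleD (n + 1) φ) := by
        intro m φ
        induction m with
        | zero => rfl
        | succ m ih =>
          rw [pow_succ', pow_succ', Module.End.mul_apply, Module.End.mul_apply,
            ← subdivide_tupleD, ih]
      have h := homotopyTo_tupleD (bary k) (subdivide (bary k)) rfl (subdivide_tupleD (bary k))
        (tupleEval σ ζ)
      rw [← tupleEval_coboundary, LinearMap.mem_ker.1 hζ,
        show tupleEval σ (0 : Cochain F X (n + 2)) = 0 from rfl, map_zero, zero_add] at h
      rw [hcomm, h, map_sub, pow_succ, Module.End.mul_apply]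
    choose m₀ hm₀ using fun σ : Simplex X n => hsmall σ stdSimplex.vertex
    refine ⟨fun σ => ∑ m ∈ Finset.range (m₀ σ), P m n (tupleEval σ ζ) stdSimplex.vertex,
      funext fun σ => ?_⟩
    -- One bound `M` for `σ` and all its faces.
    obtain ⟨M₁, hM₁⟩ := exists_subdivide_pow_eq_zero hU hV hUV σ _ (hball σ) stdSimplex.vertex
    let M := M₁ + ∑ i : Fin (n + 2), m₀ (σ.res i.succAbove)
    have hface : ∀ i : Fin (n + 2),
        ∑ m ∈ Finset.range (m₀ (σ.res i.succAbove)),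
          P m n (tupleEval (σ.res i.succAbove) ζ) stdSimplex.vertex =
        ∑ m ∈ Finset.range M, P m n (tupleEval (σ.res i.succAbove) ζ) stdSimplex.vertex := by
      intro i
      refine Finset.sum_subset (Finset.range_subset_range.2 ?_) fun m _ hm =>
        hm₀ _ m (by simpa using hm)
      exact (Finset.single_le_sum (f := fun i : Fin (n + 2) => m₀ (σ.res i.succAbove))
        (fun _ _ => Nat.zero_le _) (Finset.mem_univ i)).trans (Nat.le_add_left _ _)
    calc _ = ∑ i : Fin (n + 2), (-1) ^ (i : ℕ) * ∑ m ∈ Finset.range M,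
          P m n (tupleEval (σ.res i.succAbove) ζ) stdSimplex.vertex := by
            rw [coboundary_apply]
            exact Finset.sum_congr rfl fun i _ => by rw [hface]
      _ = ∑ m ∈ Finset.range M, coboundary n (singularOp (P m) ζ) σ := by
            simp only [Finset.mul_sum]
            rw [Finset.sum_comm]
            rfl
      _ = ∑ m ∈ Finset.range M,
          ((subdivide (bary (n + 1)) (n + 2) ^ m) (tupleEval σ ζ) stdSimplex.vertex -
            (subdivide (bary (n + 1)) (n + 2) ^ (m + 1)) (tupleEval σ ζ) stdSimplex.vertex) :=
            Finset.sum_congr rfl fun m _ => by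
              rw [coboundary_singularOp _ (hPnat m), hstep]
              rfl
      _ = ζ σ := by
            rw [Finset.sum_range_sub', hM₁ M (Nat.le_add_right _ _), sub_zero, pow_zero,
              Module.End.one_apply, tupleEval_vertex]

end Small

/-! ### The cohomology algebra: classes of cocycles, associativity, graded commutativity -/

section Algebra

variable {F : Type*} [Field F] {X : Type*} [TopologicalSpace X]

theorem coboundary_coboundary {n : ℕ} (φ : Cochain F X n) :
    coboundary (n + 1) (coboundary n φ) = 0 := by
  funext σ
  rw [← tupleEval_vertex σ (coboundary (n + 1) (coboundary n φ)), tupleEval_coboundary,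
    tupleEval_coboundary, tupleD_tupleD]
  rfl

theorem coboundaries_le_cocycles (n : ℕ) : coboundaries F X n ≤ cocycles F X n := by
  intro φ hφ
  cases n with
  | zero =>
    rw [(Submodule.mem_bot F).1 hφ]
    exact Submodule.zero_mem _
  | succ n =>
    obtain ⟨η, rfl⟩ := hφ
    exact coboundary_coboundary η

/-- The cohomology class of a cocycle. -/
def toH (n : ℕ) : cocycles F X n →ₗ[F] H F X n :=
  Submodule.mkQ ((coboundaries F X n).submoduleOf (cocycles F X n))

theorem toH_surjective (n : ℕ) : Function.Surjective (toH (F := F) (X := X) n) :=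
  Submodule.mkQ_surjective _

theorem toH_eq_zero {n : ℕ} {φ : cocycles F X n} : toH n φ = 0 ↔ φ.1 ∈ coboundaries F X n :=
  Submodule.Quotient.mk_eq_zero _

/-- The cohomology class of a cocycle of degree `n` as an element of the cohomology algebra. -/
def cohomologyClass {n : ℕ} (φ : Cochain F X n) (hφ : φ ∈ cocycles F X n) : Cohomology F X :=
  DirectSum.of (H F X) n (toH n ⟨φ, hφ⟩)

theorem exists_cohomologyClass {n : ℕ} (x : H F X n) :
    ∃ φ, ∃ hφ : φ ∈ cocycles F X n, DirectSum.of (H F X) n x = cohomologyClass φ hφ := by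
  obtain ⟨φ, rfl⟩ := toH_surjective n x
  exact ⟨φ.1, φ.2, rfl⟩

theorem cohomologyClass_eq {n : ℕ} {φ ψ : Cochain F X n} (hφ : φ ∈ cocycles F X n)
    (hψ : ψ ∈ cocycles F X n) (h : φ - ψ ∈ coboundaries F X n) :
    cohomologyClass φ hφ = cohomologyClass ψ hψ := by
  have : toH n ((⟨φ, hφ⟩ : cocycles F X n) - ⟨ψ, hψ⟩) = 0 := toH_eq_zero.2 h
  rw [map_sub, sub_eq_zero] at this
  exact congrArg _ this

theorem cohomologyClass_mul {p q n : ℕ} (h : p + q = n) {φ : Cochain F X p} {ψ : Cochain F X q}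
    (hφ : φ ∈ cocycles F X p) (hψ : ψ ∈ cocycles F X q) :
    cohomologyClass φ hφ * cohomologyClass ψ hψ =
      cohomologyClass (cup h φ ψ) (cup_mem_cocycles h hφ hψ) := by
  subst h
  exact of_mul_of _ _

theorem cohomology_mul_assoc (a b c : Cohomology F X) : a * b * c = a * (b * c) := by
  induction a using DirectSum.induction_on with
  | zero => simp
  | add a a' ha ha' => simp [add_mul, ha, ha']
  | of p x =>
  induction b using DirectSum.induction_on with
  | zero => simp
  | add b b' hb hb' => simp [mul_add, add_mul, hb, hb']
  | of q y =>
  induction c using DirectSum.induction_on with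
  | zero => simp
  | add c c' hc hc' => simp [mul_add, hc, hc']
  | of s z =>
  obtain ⟨φ, hφ, e⟩ := exists_cohomologyClass x
  obtain ⟨ψ, hψ, e'⟩ := exists_cohomologyClass y
  obtain ⟨χ, hχ, e''⟩ := exists_cohomologyClass z
  rw [e, e', e'', cohomologyClass_mul rfl, cohomologyClass_mul rfl, cohomologyClass_mul rfl,
    cohomologyClass_mul (show p + (q + s) = p + q + s by omega)]
  congr 1
  funext σ
  simp only [cup_apply, Simplex.res_res, mul_assoc]
  have h : backFace (rfl : p + q + s = p + q + s) =
      backFace (show p + (q + s) = p + q + s by omega) ∘ backFace (rfl : q + s = q + s) := by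
    funext i
    ext
    simp [backFace, add_assoc]
  rw [h]
  rfl

/-- The cochain map `φ ↦ ± φ(v_n, …, v_1)` reversing tuples, the sign being that of the reversal of
`n` letters. -/
def reverse (F V : Type*) [Field F] (n : ℕ) : TupleCochain F V n →ₗ[F] TupleCochain F V n where
  toFun φ v := (-1) ^ n.choose 2 * φ (v ∘ Fin.rev)
  map_add' φ ψ := by
    funext v
    simp [mul_add]
  map_smul' c φ := by
    funext v
    simp [mul_left_comm]

theorem reverse_apply {V : Type*} {n : ℕ} (φ : TupleCochain F V n) (v : Fin n → V) :
    reverse F V n φ v = (-1) ^ n.choose 2 * φ (v ∘ Fin.rev) := rfl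

theorem reverse_tupleD {V : Type*} (n : ℕ) (φ : TupleCochain F V n) :
    reverse F V (n + 1) (tupleD n φ) = tupleD n (reverse F V n φ) := by
  funext v
  rw [reverse_apply, tupleD_apply, tupleD_apply, Finset.mul_sum, ← Equiv.sum_comp Fin.revPerm]
  refine Finset.sum_congr rfl fun i _ => ?_
  have h : (v ∘ Fin.rev) ∘ (Fin.rev i).succAbove = (v ∘ i.succAbove) ∘ Fin.rev := by
    funext j
    simp [Fin.rev_succAbove]
  have hi : (i : ℕ) ≤ n := by omega
  have hs : ((-1 : F)) ^ (n + 1).choose 2 * (-1) ^ (Fin.rev i : ℕ) =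
      (-1) ^ (i : ℕ) * (-1) ^ n.choose 2 := by
    rw [← pow_add, ← pow_add, Nat.choose_succ_succ' n 1, Nat.choose_one_right, Fin.val_rev]
    rw [show n + n.choose 2 + (n + 1 - ((i : ℕ) + 1)) =
      (i + n.choose 2) + 2 * (n - i) by omega, pow_add, pow_mul]
    simp
  rw [Fin.revPerm_apply, h, reverse_apply, ← mul_assoc, ← mul_assoc, hs]

/-- The cochain map `φ ↦ ± φ(σ ∘ reversal)`, which is homotopic to the identity. -/
def reverseCochain {n : ℕ} (φ : Cochain F X n) : Cochain F X n :=
  singularOp (fun _ => reverse F _ (n + 1)) φ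

theorem reverseCochain_apply {n : ℕ} (φ : Cochain F X n) (σ : Simplex X n) :
    reverseCochain φ σ = (-1) ^ (n + 1).choose 2 * φ (σ.res Fin.rev) := by
  rw [← tupleEval_vertex_comp σ Fin.rev φ]
  rfl

theorem sub_reverseCochain_mem_coboundaries {n : ℕ} {φ : Cochain F X n}
    (hφ : φ ∈ cocycles F X n) : φ - reverseCochain φ ∈ coboundaries F X n := by
  refine sub_singularOp_mem_coboundaries (fun k n => reverse F _ n) (fun k => ?_)
    (fun k n ψ => reverse_tupleD n ψ) (fun f n ψ => rfl) hφ
  ext φ v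
  simp [reverse_apply, Subsingleton.elim (v ∘ Fin.rev) v]

theorem reverseCochain_mem_cocycles {n : ℕ} {φ : Cochain F X n} (hφ : φ ∈ cocycles F X n) :
    reverseCochain φ ∈ cocycles F X n := by
  have := Submodule.sub_mem _ hφ
    (coboundaries_le_cocycles n (sub_reverseCochain_mem_coboundaries hφ))
  rwa [sub_sub_cancel] at this

/-- The signs of the reversals of a simplex and of its front and back faces differ by
`(-1) ^ (p * q)`, which is the sign in graded commutativity. -/
theorem choose_two_add (p q : ℕ) :
    (p + q + 1).choose 2 = (p + 1).choose 2 + (q + 1).choose 2 + p * q := by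
  induction q with
  | zero => simp
  | succ q ih =>
    rw [← add_assoc, Nat.choose_succ_succ' (p + q + 1) 1, ih, Nat.choose_succ_succ' (q + 1) 1,
      Nat.choose_one_right, Nat.choose_one_right]
    ring

theorem reverseCochain_cup {p q : ℕ} (φ : Cochain F X p) (ψ : Cochain F X q) :
    reverseCochain (cup (add_comm q p) ψ φ) =
      (-1 : F) ^ (p * q) • cup rfl (reverseCochain φ) (reverseCochain ψ) := by
  funext σ
  rw [Pi.smul_apply, smul_eq_mul, cup_apply, reverseCochain_apply, reverseCochain_apply,
    reverseCochain_apply, cup_apply, choose_two_add, pow_add, pow_add]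
  simp only [Simplex.res_res]
  have h1 : Fin.rev ∘ frontFace (add_comm q p) = backFace (rfl : p + q = p + q) ∘ Fin.rev := by
    funext i
    ext
    simp [frontFace, backFace]
    omega
  have h2 : Fin.rev ∘ backFace (add_comm q p) = frontFace (rfl : p + q = p + q) ∘ Fin.rev := by
    funext i
    ext
    simp [frontFace, backFace]
    omega
  rw [h1, h2]
  ring

/-- Graded commutativity of the cup product. -/
theorem of_mul_of_comm {p q : ℕ} (x : H F X p) (y : H F X q) :
    (DirectSum.of (H F X) q y * DirectSum.of (H F X) p x : Cohomology F X) =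
      (-1 : F) ^ (p * q) • (DirectSum.of (H F X) p x * DirectSum.of (H F X) q y) := by
  obtain ⟨φ, hφ, e⟩ := exists_cohomologyClass x
  obtain ⟨ψ, hψ, e'⟩ := exists_cohomologyClass y
  have hcl : ∀ {n : ℕ} {χ : Cochain F X n} (hχ : χ ∈ cocycles F X n),
      cohomologyClass χ hχ = cohomologyClass _ (reverseCochain_mem_cocycles hχ) := fun hχ =>
    cohomologyClass_eq _ _ (sub_reverseCochain_mem_coboundaries hχ)
  rw [e, e', cohomologyClass_mul (add_comm q p), hcl, hcl hφ, hcl hψ, cohomologyClass_mul rfl,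
    cohomologyClass, cohomologyClass, smul_of, ← map_smul]
  congr 2
  exact Subtype.ext (reverseCochain_cup φ ψ)

/-! ### Homogeneous components -/

/-- A subspace of the cohomology algebra which contains the pure components of its elements. -/
def IsHomogeneousSubspace (S : Submodule F (Cohomology F X)) : Prop :=
  ∀ a ∈ S, ∀ n, DirectSum.of (H F X) n (a n) ∈ S

theorem of_component_of (p n : ℕ) (x : H F X p) :
    DirectSum.of (H F X) n (DirectSum.of (H F X) p x n) =
      if p = n then DirectSum.of (H F X) p x else 0 := by
  split_ifs with h
  · subst h
    rw [DirectSum.of_eq_same]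
  · rw [DirectSum.of_eq_of_ne _ _ _ (Ne.symm h), map_zero]

theorem mul_mem_of_components {A B C : Submodule F (Cohomology F X)} {a b : Cohomology F X}
    (ha : ∀ n, DirectSum.of (H F X) n (a n) ∈ A) (hb : ∀ n, DirectSum.of (H F X) n (b n) ∈ B)
    (h : ∀ p q (x : H F X p) (y : H F X q), DirectSum.of (H F X) p x ∈ A →
      DirectSum.of (H F X) q y ∈ B →
        DirectSum.of (H F X) p x * DirectSum.of (H F X) q y ∈ C) : a * b ∈ C := by
  classical
  rw [← DirectSum.sum_support_of a, ← DirectSum.sum_support_of b, Finset.sum_mul_sum]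
  exact C.sum_mem fun p _ => C.sum_mem fun q _ => h p q _ _ (ha p) (hb q)

/-- The pure components of a product are sums of products of pure components, so they stay in any
subspace `C` with `A ∧ B ⊂ C`. -/
theorem mul_component_mem {A B C : Submodule F (Cohomology F X)} {a b : Cohomology F X}
    (ha : ∀ n, DirectSum.of (H F X) n (a n) ∈ A) (hb : ∀ n, DirectSum.of (H F X) n (b n) ∈ B)
    (h : ∀ a ∈ A, ∀ b ∈ B, a * b ∈ C) (n : ℕ) : DirectSum.of (H F X) n ((a * b) n) ∈ C := by
  let D : Submodule F (Cohomology F X) := C.comap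
    (DirectSum.lof F ℕ (H F X) n ∘ₗ DirectSum.component F ℕ (H F X) n)
  refine mul_mem_of_components (C := D) ha hb fun p q x y hx hy => ?_
  change DirectSum.of (H F X) n ((DirectSum.of (H F X) p x * DirectSum.of (H F X) q y :
    Cohomology F X) n) ∈ C
  have := h _ hx _ hy
  rw [of_mul_of] at this ⊢
  rw [of_component_of]
  split_ifs
  exacts [this, C.zero_mem]

theorem isGraded_adjoin {s : Set (Cohomology F X)}
    (hs : ∀ a ∈ s, ∀ n, DirectSum.of (H F X) n (a n) ∈ s) :
    IsGraded (NonUnitalAlgebra.adjoin F s) := by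
  intro a ha
  induction ha using NonUnitalAlgebra.adjoin_induction with
  | mem a ha => exact fun n => NonUnitalAlgebra.subset_adjoin F (hs a ha n)
  | add a b _ _ ha hb =>
    intro n
    rw [DirectSum.add_apply, map_add]
    exact add_mem (ha n) (hb n)
  | zero =>
    intro n
    rw [DirectSum.zero_apply, map_zero]
    exact zero_mem _
  | mul a b _ _ ha hb =>
    exact mul_component_mem (A := (NonUnitalAlgebra.adjoin F s).toSubmodule)
      (B := (NonUnitalAlgebra.adjoin F s).toSubmodule)
      (C := (NonUnitalAlgebra.adjoin F s).toSubmodule) ha hb fun _ h _ h' =>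
        (NonUnitalAlgebra.adjoin F s).mul_mem h h'
  | smul c a _ ha =>
    intro n
    rw [DirectSum.smul_apply, ← smul_of]
    exact SMulMemClass.smul_mem c (ha n)

theorem pullback_apply {Y : Type*} [TopologicalSpace Y] (g : C(X, Y)) (a : Cohomology F Y)
    (n : ℕ) : pullback F g a n = pullbackH F g n (a n) := rfl

theorem pullback_of {Y : Type*} [TopologicalSpace Y] (g : C(X, Y)) {n : ℕ} (x : H F Y n) :
    pullback F g (DirectSum.of (H F Y) n x) = DirectSum.of (H F X) n (pullbackH F g n x) :=
  DirectSum.lmap_lof (pullbackH F g) n x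

end Algebra

/-! ### Supports of products -/

section Support

variable {F : Type*} [Field F] {X : Type*} [TopologicalSpace X]

/-- A cocycle which is a coboundary on `U` is cohomologous to one which vanishes on the simplices
inside `U`: subtract the coboundary of the extension by zero of a primitive. -/
theorem exists_vanishesInside {U : Set X} {n : ℕ} {φ : Cochain F X n} (hφ : φ ∈ cocycles F X n)
    (h : pullbackCochain F (⟨Subtype.val, continuous_subtype_val⟩ : C(U, X)) n φ ∈
      coboundaries F U n) :
    ∃ ψ : Cochain F X n, ψ ∈ cocycles F X n ∧ φ - ψ ∈ coboundaries F X n ∧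
      VanishesInside ψ U := by
  classical
  let restr : ∀ {k : ℕ} (σ : Simplex X k), (∀ t, σ t ∈ U) → Simplex U k := fun σ hσ =>
    ⟨fun t => ⟨σ t, hσ t⟩, σ.continuous.subtype_mk hσ⟩
  cases n with
  | zero =>
    exact ⟨φ, hφ, by rw [sub_self]; exact Submodule.zero_mem _,
      fun σ hσ => congrFun ((Submodule.mem_bot F).1 h) (restr σ hσ)⟩
  | succ n =>
    obtain ⟨η, hη⟩ := h
    let θ : Cochain F X n := fun σ => if hσ : ∀ t, σ t ∈ U then η (restr σ hσ) else 0
    refine ⟨φ - coboundary n θ, Submodule.sub_mem _ hφ (coboundary_coboundary θ),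
      ⟨θ, (sub_sub_cancel _ _).symm⟩, fun σ hσ => ?_⟩
    rw [Pi.sub_apply, sub_eq_zero]
    refine (congrFun hη (restr σ hσ)).symm.trans ?_
    rw [coboundary_apply, coboundary_apply]
    refine Finset.sum_congr rfl fun i _ => ?_
    rw [show θ (σ.res i.succAbove) = _ from dif_pos fun t => hσ _]
    rfl

theorem restrictTo_cohomologyClass_eq_zero {U : Set X} {n : ℕ} {φ : Cochain F X n}
    (hφ : φ ∈ cocycles F X n) : restrictTo U (cohomologyClass φ hφ) = 0 ↔
      pullbackCochain F (⟨Subtype.val, continuous_subtype_val⟩ : C(U, X)) n φ ∈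
        coboundaries F U n := by
  rw [restrictTo, cohomologyClass, pullback_of, ← map_zero (DirectSum.of (H F U) n),
    (DirectSum.of_injective n).eq_iff]
  exact toH_eq_zero (φ := ⟨_, pullback_mem_cocycles F _ n φ hφ⟩)

/-- If `a` vanishes on `U` and `b` on `V` then `a ∧ b` vanishes on `U ∪ V`, for `U` and `V` open. -/
theorem restrictTo_union_mul_eq_zero {U V : Set X} (hU : IsOpen U) (hV : IsOpen V)
    {a b : Cohomology F X} (ha : restrictTo U a = 0) (hb : restrictTo V b = 0) :
    restrictTo (U ∪ V) (a * b) = 0 := by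
  have hcomp : ∀ {W : Set X} {a : Cohomology F X}, restrictTo W a = 0 →
      ∀ n, DirectSum.of (H F X) n (a n) ∈ LinearMap.ker (restrictTo (F := F) W) := by
    intro W a ha n
    rw [LinearMap.mem_ker, restrictTo, pullback_of, ← pullback_apply]
    change DirectSum.of _ n (restrictTo W a n) = 0
    rw [ha, DirectSum.zero_apply, map_zero]
  refine LinearMap.mem_ker.1 (mul_mem_of_components (hcomp ha) (hcomp hb) ?_)
  intro p q x y hx hy
  obtain ⟨φ, hφ, e⟩ := exists_cohomologyClass x
  obtain ⟨ψ, hψ, e'⟩ := exists_cohomologyClass y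
  rw [e, LinearMap.mem_ker, restrictTo_cohomologyClass_eq_zero] at hx
  rw [e', LinearMap.mem_ker, restrictTo_cohomologyClass_eq_zero] at hy
  obtain ⟨φ', hφ', hd, hφU⟩ := exists_vanishesInside hφ hx
  obtain ⟨ψ', hψ', hd', hψV⟩ := exists_vanishesInside hψ hy
  rw [e, e', cohomologyClass_eq hφ hφ' hd, cohomologyClass_eq hψ hψ' hd', cohomologyClass_mul rfl,
    LinearMap.mem_ker, restrictTo_cohomologyClass_eq_zero]
  refine mem_coboundaries_of_vanishesInside (hU.preimage continuous_subtype_val)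
    (hV.preimage continuous_subtype_val) (Set.eq_univ_of_forall fun x => x.2)
    (pullback_mem_cocycles F _ _ _ (cup_mem_cocycles rfl hφ' hψ')) (fun σ hσ => ?_)
    fun σ hσ => ?_
  · exact mul_eq_zero_of_left (hφU _ fun t => hσ _) _
  · exact mul_eq_zero_of_right _ (hψV _ fun t => hσ _)

theorem SupportedIn.mul {a b : Cohomology F X} {O O' : Set X} (ha : SupportedIn a O)
    (hb : SupportedIn b O') : SupportedIn (a * b) (O ∩ O') := by
  obtain ⟨U, hU, hOU, haU⟩ := ha
  obtain ⟨V, hV, hOV, hbV⟩ := hb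
  refine ⟨U ∪ V, hU.union hV, ?_, restrictTo_union_mul_eq_zero hU hV haU hbV⟩
  rw [Set.inter_union_distrib_right, ← Set.union_assoc, hOU, Set.univ_union, Set.univ_inter,
    Set.union_left_comm, hOV, Set.union_univ]

theorem SupportedIn.mono {a : Cohomology F X} {O O' : Set X} (h : O ⊆ O')
    (ha : SupportedIn a O) : SupportedIn a O' := by
  obtain ⟨U, hU, hOU, haU⟩ := ha
  exact ⟨U, hU, Set.univ_subset_iff.1 (hOU ▸ Set.union_subset_union_left U h), haU⟩

theorem SupportedIn.of_component {a : Cohomology F X} {O : Set X} (ha : SupportedIn a O) (n : ℕ) :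
    SupportedIn (DirectSum.of (H F X) n (a n)) O := by
  obtain ⟨U, hU, hOU, haU⟩ := ha
  refine ⟨U, hU, hOU, ?_⟩
  rw [restrictTo, pullback_of, ← pullback_apply]
  change DirectSum.of _ n (restrictTo U a n) = 0
  rw [haU, DirectSum.zero_apply, map_zero]

theorem isHomogeneousSubspace_supported {A : NonUnitalSubalgebra F (Cohomology F X)}
    (hA : IsGraded A) (O : Set X) : IsHomogeneousSubspace (supported A.toSubmodule O) :=
  fun a ha n => ⟨hA a ha.1 n, ha.2.of_component n⟩

theorem isHomogeneousSubspace_supportedDeg {A : NonUnitalSubalgebra F (Cohomology F X)}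
    (hA : IsGraded A) (O : Set X) (s t : ℝ) :
    IsHomogeneousSubspace (supportedDeg A.toSubmodule O s t) := by
  refine fun a ha n => ⟨isHomogeneousSubspace_supported hA O a ha.1 n, fun m hm => ?_⟩
  by_cases h : m = n
  · subst h
    rw [DirectSum.of_eq_same] at hm
    exact ha.2 m hm
  · exact absurd (DirectSum.of_eq_of_ne _ _ _ h) hm

/-- Degrees add under the cup product. -/
theorem mul_degree_mem {a b : Cohomology F X} {s t s' t' : ℝ}
    (ha : ∀ n : ℕ, a n ≠ 0 → s < n ∧ (n : ℝ) < t)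
    (hb : ∀ n : ℕ, b n ≠ 0 → s' < n ∧ (n : ℝ) < t') (n : ℕ) (h : (a * b) n ≠ 0) :
    s + s' < n ∧ (n : ℝ) < t + t' := by
  classical
  by_contra hn
  refine h ?_
  rw [← DirectSum.sum_support_of a, ← DirectSum.sum_support_of b, Finset.sum_mul_sum,
    DFinsupp.finsetSum_apply]
  refine Finset.sum_eq_zero fun p hp => ?_
  rw [DFinsupp.finsetSum_apply]
  refine Finset.sum_eq_zero fun q hq => ?_
  rw [of_mul_of]
  refine DirectSum.of_eq_of_ne _ _ _ ?_
  rintro rfl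
  have h1 := ha p (DFinsupp.mem_support_iff.1 hp)
  have h2 := hb q (DFinsupp.mem_support_iff.1 hq)
  push_cast at hn
  exact hn ⟨by linarith, by linarith⟩

end Support

/-! ### Ranks of products -/

section Rank

variable {F : Type*} [Field F] {X : Type*} [TopologicalSpace X]

/-- The range of a linear map has a basis of images of members of a given spanning set. -/
theorem exists_linearIndependent_comp_of_span_eq_top {M : Type*} {N : Type*} [AddCommGroup M]
    [Module F M] [AddCommGroup N] [Module F N] (f : M →ₗ[F] N) {s : Set M}
    (hs : Submodule.span F s = ⊤) : ∃ (t : Set N) (v : t → M), (∀ i, v i ∈ s) ∧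
      LinearIndependent F (fun i => f (v i)) ∧ Cardinal.mk t = LinearMap.rank f := by
  obtain ⟨t, hts, hspan, hli⟩ := exists_linearIndependent F (f '' s)
  choose v hv using fun i : t => hts i.2
  refine ⟨t, v, fun i => (hv i).1, ?_, ?_⟩
  · simpa only [(hv _).2] using hli
  · rw [LinearMap.rank, LinearMap.range_eq_map, ← hs, Submodule.map_span, ← hspan]
    exact (rank_span_set hli).symm

theorem cardinalMk_le_rank_of_linearIndependent_comp.{u} {M : Type*} {N : Type u} [AddCommGroup M]
    [Module F M] [AddCommGroup N] [Module F N] (f : M →ₗ[F] N) {ι : Type u} {v : ι → M}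
    (h : LinearIndependent F fun i => f (v i)) : Cardinal.mk ι ≤ LinearMap.rank f :=
  (LinearIndependent.of_comp (v := fun i => f.rangeRestrict (v i)) f.range.subtype
    h).cardinal_le_rank

theorem span_homogeneous_eq_top {S : Submodule F (Cohomology F X)}
    (hS : IsHomogeneousSubspace S) :
    Submodule.span F {v : S | ∃ p x, v.1 = DirectSum.of (H F X) p x} = ⊤ := by
  classical
  refine eq_top_iff.2 fun v _ => ?_
  have : v = ∑ n ∈ DFinsupp.support v.1, (⟨DirectSum.of (H F X) n (v.1 n), hS v.1 v.2 n⟩ : S) := by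
    ext1
    rw [AddSubmonoidClass.coe_finsetSum]
    exact (DirectSum.sum_support_of v.1).symm
  rw [this]
  exact Submodule.sum_mem _ fun n _ => Submodule.subset_span ⟨n, _, rfl⟩

/-- Moving the second factor past the third one in a product of four. -/
theorem mul_of_mul_of_mul (a b' : Cohomology F X) {p q : ℕ} (x : H F X p) (y : H F X q) :
    a * DirectSum.of (H F X) p x * (DirectSum.of (H F X) q y * b') =
      (-1 : F) ^ (q * p) • (a * DirectSum.of (H F X) q y * (DirectSum.of (H F X) p x * b')) := by
  rw [cohomology_mul_assoc, ← cohomology_mul_assoc (DirectSum.of (H F X) p x), of_mul_of_comm y x,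
    smul_mul_assoc, mul_smul_comm, cohomology_mul_assoc, cohomology_mul_assoc]

/-- A relation `∑ⱼ εⱼ xⱼ ∧ (a'ⱼ ∧ b') = 0` valid for all `b' ∈ W'`, with `xⱼ ∈ B` and `εⱼ ≠ 0`, is
trivial when `B ⊗ B' → H⋆(X; F)` is injective and the maps `b' ↦ a'ⱼ ∧ b'` are independent: lift it
to `B ⊗ B'` and apply a linear functional of `B`. -/
theorem eq_zero_of_sum_mul_eq_zero {B B' : NonUnitalSubalgebra F (Cohomology F X)}
    (hinj : Function.Injective (cupTensor B B')) {V' W' : Submodule F (Cohomology F X)}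
    (hV' : V' ≤ B'.toSubmodule) (hW' : W' ≤ B'.toSubmodule) {κ : Type*} {a' : κ → V'}
    (hli : LinearIndependent F fun j =>
      (LinearMap.mul F (Cohomology F X)).domRestrict₁₂ V' W' (a' j))
    {s : Finset κ} {x : κ → Cohomology F X} (hx : ∀ j, x j ∈ B) {ε : κ → F} (hε : ∀ j, ε j ≠ 0)
    (h : ∀ b' ∈ W', ∑ j ∈ s, ε j • (x j * ((a' j : Cohomology F X) * b')) = 0) :
    ∀ j ∈ s, x j = 0 := by
  intro j hj
  suffices hz : (⟨x j, hx j⟩ : B.toSubmodule) = 0 from congrArg Subtype.val hz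
  rw [← Module.forall_dual_apply_eq_zero_iff F]
  intro L
  have hmem : ∀ (b' : W') j, (a' j : Cohomology F X) * b' ∈ B'.toSubmodule := fun b' j =>
    B'.mul_mem (hV' (a' j).2) (hW' b'.2)
  have hrel : ∑ j ∈ s, (L ⟨x j, hx j⟩ * ε j) •
      (LinearMap.mul F (Cohomology F X)).domRestrict₁₂ V' W' (a' j) = 0 := by
    refine LinearMap.ext fun b' => ?_
    have ht : ∑ j ∈ s, ε j • ((⟨x j, hx j⟩ : B.toSubmodule) ⊗ₜ[F]
        (⟨(a' j : Cohomology F X) * b', hmem b' j⟩ : B'.toSubmodule)) = 0 := by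
      refine hinj ?_
      rw [map_sum, map_zero, ← h b' b'.2]
      exact Finset.sum_congr rfl fun j _ => map_smul _ _ _
    have := congrArg (fun z => ((TensorProduct.lid F B'.toSubmodule
      (LinearMap.rTensor B'.toSubmodule L z) : B'.toSubmodule) : Cohomology F X)) ht
    simp only [map_sum, map_smul, LinearMap.rTensor_tmul, TensorProduct.lid_tmul, map_zero,
      AddSubmonoidClass.coe_finsetSum, Submodule.coe_smul, ZeroMemClass.coe_zero] at this
    rw [LinearMap.sum_apply, LinearMap.zero_apply, ← this]
    refine Finset.sum_congr rfl fun j _ => ?_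
    rw [mul_comm, mul_smul]
    rfl
  exact (mul_eq_zero.1 (linearIndependent_iff'.1 hli s _ hrel j hj)).resolve_right (hε j)

/-- The rank of the cup product pairing is supermultiplicative for subspaces of two subalgebras
`B` and `B'` with `B ⊗ B' → H⋆(X; F)` injective. If the pairings with `aᵢ ∈ V` and with pure
`a'ⱼ ∈ V'` are independent, so are those with `aᵢ ∧ a'ⱼ`, as one sees on products `b ∧ b'` with `b`
pure: `(aᵢ ∧ a'ⱼ) ∧ (b ∧ b') = ± (aᵢ ∧ b) ∧ (a'ⱼ ∧ b')`. -/
theorem rank_mul_rank_le {B B' : NonUnitalSubalgebra F (Cohomology F X)}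
    (hinj : Function.Injective (cupTensor B B')) {V W V' W' V'' W'' : Submodule F (Cohomology F X)}
    (hV : V ≤ B.toSubmodule) (hW : W ≤ B.toSubmodule)
    (hV' : V' ≤ B'.toSubmodule) (hW' : W' ≤ B'.toSubmodule)
    (hWh : IsHomogeneousSubspace W) (hVh' : IsHomogeneousSubspace V')
    (hVV : ∀ a ∈ V, ∀ a' ∈ V', a * a' ∈ V'') (hWW : ∀ b ∈ W, ∀ b' ∈ W', b * b' ∈ W'') :
    LinearMap.rank ((LinearMap.mul F (Cohomology F X)).domRestrict₁₂ V W) *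
        LinearMap.rank ((LinearMap.mul F (Cohomology F X)).domRestrict₁₂ V' W') ≤
      LinearMap.rank ((LinearMap.mul F (Cohomology F X)).domRestrict₁₂ V'' W'') := by
  classical
  obtain ⟨ι, a, -, hli, hι⟩ := exists_linearIndependent_comp_of_span_eq_top
    ((LinearMap.mul F (Cohomology F X)).domRestrict₁₂ V W) (s := Set.univ) Submodule.span_univ
  obtain ⟨κ, a', ha', hli', hκ⟩ := exists_linearIndependent_comp_of_span_eq_top
    ((LinearMap.mul F (Cohomology F X)).domRestrict₁₂ V' W') (span_homogeneous_eq_top hVh')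
  choose p x hpx using ha'
  rw [← hι, ← hκ, Cardinal.mul_def]
  refine cardinalMk_le_rank_of_linearIndependent_comp _
    (v := fun k : ι × κ => ⟨a k.1 * a' k.2, hVV _ (a k.1).2 _ (a' k.2).2⟩) ?_
  rw [linearIndependent_iff']
  intro s g hg
  -- The coefficients, extended by zero to a rectangle containing `s`.
  let c : ι → κ → F := fun i j => if (i, j) ∈ s then g (i, j) else 0
  let s₁ := s.image Prod.fst
  let s₂ := s.image Prod.snd
  have hsub : s ⊆ s₁ ×ˢ s₂ := fun k hk => Finset.mem_product.2
    ⟨Finset.mem_image_of_mem _ hk, Finset.mem_image_of_mem _ hk⟩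
  have hrel : ∀ b ∈ W, ∀ b' ∈ W',
      ∑ j ∈ s₂, ∑ i ∈ s₁, c i j • ((a i : Cohomology F X) * a' j * (b * b')) = 0 := by
    intro b hb b' hb'
    have h := LinearMap.congr_fun hg ⟨b * b', hWW b hb b' hb'⟩
    rw [LinearMap.sum_apply] at h
    rw [← Finset.sum_product_right', ← Finset.sum_subset hsub]
    · refine (Finset.sum_congr rfl fun k hk => ?_).trans h
      simp only [c, Prod.mk.eta, if_pos hk]
      rfl
    · intro k _ hk
      simp only [c, if_neg hk, zero_smul]
  have hpure : ∀ (q : ℕ) (y : H F X q), DirectSum.of (H F X) q y ∈ W → ∀ j ∈ s₂,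
      ∑ i ∈ s₁, c i j • ((a i : Cohomology F X) * DirectSum.of (H F X) q y) = 0 := by
    intro q y hy
    refine eq_zero_of_sum_mul_eq_zero hinj hV' hW' hli' (ε := fun j => (-1) ^ (q * p j))
      (fun j => ?_) (fun j => pow_ne_zero _ (neg_ne_zero.2 one_ne_zero)) fun b' hb' => ?_
    · exact B.toSubmodule.sum_mem fun i _ => B.toSubmodule.smul_mem _
        (B.mul_mem (hV (a i).2) (hW hy))
    · rw [← hrel _ hy b' hb']
      refine Finset.sum_congr rfl fun j _ => ?_
      rw [Finset.sum_mul, Finset.smul_sum]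
      refine Finset.sum_congr rfl fun i _ => ?_
      rw [hpx j, mul_of_mul_of_mul, smul_mul_assoc, smul_comm]
  have hzero : ∀ j ∈ s₂, ∑ i ∈ s₁, c i j •
      (LinearMap.mul F (Cohomology F X)).domRestrict₁₂ V W (a i) = 0 := by
    intro j hj
    refine LinearMap.ext fun b => ?_
    rw [LinearMap.sum_apply, LinearMap.zero_apply]
    calc _ = ∑ i ∈ s₁, c i j • ((a i : Cohomology F X) * b) := rfl
      _ = ∑ i ∈ s₁, ∑ q ∈ DFinsupp.support b.1,
          c i j • ((a i : Cohomology F X) * DirectSum.of (H F X) q (b.1 q)) := by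
        refine Finset.sum_congr rfl fun i _ => ?_
        rw [← Finset.smul_sum, ← Finset.mul_sum, DirectSum.sum_support_of]
      _ = 0 := by
        rw [Finset.sum_comm]
        exact Finset.sum_eq_zero fun q _ => hpure q _ (hWh b.1 b.2 q) j hj
  intro k hk
  have := linearIndependent_iff'.1 hli s₁ _ (hzero k.2 (Finset.mem_image_of_mem _ hk)) k.1
    (Finset.mem_image_of_mem _ hk)
  simpa only [c, Prod.mk.eta, if_pos hk] using this

end Rank

/-! ### Interiors of finite subsets and averages -/

section Metric

variable {Γ : Type*} [MetricSpace Γ]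

theorem setDist_le_edist {S S' : Set Γ} {γ γ' : Γ} (h : γ ∈ S) (h' : γ' ∈ S') :
    setDist S S' ≤ edist γ γ' :=
  (iInf₂_le γ h).trans (iInf₂_le (f := fun γ' (_ : γ' ∈ S') => edist γ γ') γ' h')

theorem mem_interior {r : ℝ} {Ω : Finset Γ} {γ : Γ} : γ ∈ interior r Ω ↔
    γ ∈ Ω ∧ ENNReal.ofReal r < setDist {γ} (Ω : Set Γ)ᶜ := by
  simp only [interior, Finset.mem_filter]
  refine and_congr_right fun h => ?_
  have h0 : setDist {γ} (Ω : Set Γ) = 0 := by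
    refine le_antisymm ((setDist_le_edist (Set.mem_singleton γ) h).trans ?_) bot_le
    rw [edist_self]
  simp only [boundary, Set.mem_ofPred_eq, h0, zero_le, true_and, not_le]

theorem mem_of_mem_interior {r : ℝ} {Ω : Finset Γ} {γ z : Γ} (h : γ ∈ interior r Ω)
    (hz : dist γ z ≤ r) : z ∈ Ω := by
  by_contra hzΩ
  refine (mem_interior.1 h).2.not_ge ((setDist_le_edist (Set.mem_singleton γ) hzΩ).trans ?_)
  rw [edist_dist]
  exact ENNReal.ofReal_le_ofReal hz

theorem interior_mono {r : ℝ} {Ω Ω' : Finset Γ} (h : Ω ⊆ Ω') : interior r Ω ⊆ interior r Ω' := by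
  intro γ hγ
  rw [mem_interior] at hγ ⊢
  refine ⟨h hγ.1, hγ.2.trans_le ?_⟩
  exact iInf₂_mono fun γ _ => iInf₂_mono' fun z hz => ⟨z, fun hz' => hz (h hz'), le_rfl⟩

/-- The interiors of disjoint sets are more than `N` apart if any two points at distance at most
`N` have a common `r`-neighbour: such a neighbour would lie in both sets. -/
theorem lt_setDist_interior {r N : ℝ}
    (hr : ∀ γ γ' : Γ, dist γ γ' ≤ N → ∃ z : Γ, dist γ z ≤ r ∧ dist z γ' ≤ r)
    {Ω Ω' : Finset Γ} (hdisj : Disjoint Ω Ω') (hN : 0 ≤ N) :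
    ENNReal.ofReal N < setDist (interior r Ω : Set Γ) (interior r Ω' : Set Γ) := by
  have e : setDist (interior r Ω : Set Γ) (interior r Ω' : Set Γ) =
      (interior r Ω).inf fun γ => (interior r Ω').inf fun γ' => edist γ γ' := by
    simp only [setDist, Finset.inf_eq_iInf, Finset.mem_coe]
  rw [e, Finset.lt_inf_iff ENNReal.ofReal_lt_top]
  intro γ hγ
  rw [Finset.lt_inf_iff ENNReal.ofReal_lt_top]
  intro γ' hγ'
  by_contra hlt
  rw [not_lt, edist_dist, ENNReal.ofReal_le_ofReal_iff hN] at hlt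
  obtain ⟨z, hz, hz'⟩ := hr γ γ' hlt
  rw [dist_comm] at hz'
  exact Finset.disjoint_left.1 hdisj (mem_of_mem_interior hγ hz) (mem_of_mem_interior hγ' hz')

end Metric

section Action

variable {Γ : Type*} [Group Γ] {X : Type*} [MulAction Γ X]

/-- The average over a disjoint union is the convex combination of the averages. -/
theorem average_union [DecidableEq Γ] (f₀ : X → ℝ) {Ω Ω' : Finset Γ} (hdisj : Disjoint Ω Ω')
    (x : X) : average f₀ (Ω ∪ Ω') x =
      (Ω.card / (Ω ∪ Ω').card : ℝ) * average f₀ Ω x +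
        (1 - (Ω.card / (Ω ∪ Ω').card : ℝ)) * average f₀ Ω' x := by
  rcases Ω.eq_empty_or_nonempty with rfl | hΩ
  · simp
  have h1 : (0 : ℝ) < Ω.card := by exact_mod_cast hΩ.card_pos
  rcases Ω'.eq_empty_or_nonempty with rfl | hΩ'
  · simp [div_self h1.ne']
  have h2 : (0 : ℝ) < Ω'.card := by exact_mod_cast hΩ'.card_pos
  rw [average, average, average, Finset.sum_union hdisj, Finset.card_union_of_disjoint hdisj]
  push_cast
  field_simp
  ring

variable [TopologicalSpace X] [ContinuousConstSMul Γ X] {F : Type*} [Field F]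

theorem isGraded_genAlg {A : NonUnitalSubalgebra F (Cohomology F X)} (hA : IsGraded A)
    (Ω : Finset Γ) : IsGraded (genAlg A Ω) := by
  refine isGraded_adjoin fun a ha n => ?_
  obtain ⟨γ, hγ, a, haA, rfl⟩ := Set.mem_iUnion₂.1 ha
  refine Set.mem_iUnion₂.2 ⟨γ, hγ, DirectSum.of (H F X) n (a n), hA a haA n, ?_⟩
  exact pullback_of _ _

theorem genAlg_mono (A : NonUnitalSubalgebra F (Cohomology F X)) {Ω Ω' : Finset Γ} (h : Ω ⊆ Ω') :
    genAlg A Ω ≤ genAlg A Ω' :=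
  NonUnitalAlgebra.adjoin_mono (Set.biUnion_subset_biUnion_left h)

/-- Supermultiplicativity of the homological measure for a product-like action. -/
theorem homologicalMeasure_mul_le [DecidableEq Γ] [MetricSpace Γ] (f₀ : X → ℝ)
    {𝔞 : NonUnitalSubalgebra F (Cohomology F X)}
    {N : NonUnitalSubalgebra F (Cohomology F X) → ℝ} (hρ : IsProductLike (Γ := Γ) 𝔞 N)
    {A : NonUnitalSubalgebra F (Cohomology F X)} (hA : A ≤ 𝔞) (hfin : FiniteDimensional F A)
    (hgr : IsGraded A) {r : ℝ}
    (hr : ∀ γ γ' : Γ, dist γ γ' ≤ N A → ∃ z : Γ, dist γ z ≤ r ∧ dist z γ' ≤ r)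
    (ν δ : ℝ) {Ω Ω' : Finset Γ} (hdisj : Disjoint Ω Ω') (ℓ ℓ' c c' : ℝ) {α : ℝ}
    (hα : α = (Ω.card : ℝ) / ((Ω ∪ Ω').card : ℝ)) :
    homologicalMeasure f₀ A r Ω ℓ ν c δ * homologicalMeasure f₀ A r Ω' ℓ' ν c' δ ≤
      homologicalMeasure f₀ A r (Ω ∪ Ω') (α * ℓ + (1 - α) * ℓ') ν (α * c + (1 - α) * c') δ := by
  have hα0 : 0 ≤ α := by rw [hα]; positivity
  have hcard : ((Ω ∪ Ω').card : ℝ) = Ω.card + Ω'.card := by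
    rw [Finset.card_union_of_disjoint hdisj]
    push_cast
    rfl
  have hα1 : α ≤ 1 := by
    rw [hα, hcard]
    exact div_le_one_of_le₀ (by simp) (by positivity)
  have hαc : α * ((Ω ∪ Ω').card : ℝ) = Ω.card := by
    rw [hα]
    refine div_mul_cancel_of_imp fun h => ?_
    rw [hcard] at h
    linarith [Nat.cast_nonneg (α := ℝ) Ω.card, Nat.cast_nonneg (α := ℝ) Ω'.card]
  have hαc' : (1 - α) * ((Ω ∪ Ω').card : ℝ) = Ω'.card := by
    rw [sub_mul, hαc, hcard]
    ring
  have hmul : ∀ a ∈ genAlg A (interior r Ω), ∀ a' ∈ genAlg A (interior r Ω'),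
      a * a' ∈ genAlg A (interior r (Ω ∪ Ω')) := fun a ha a' ha' => mul_mem
    (genAlg_mono A (interior_mono Finset.subset_union_left) ha)
    (genAlg_mono A (interior_mono Finset.subset_union_right) ha')
  -- A convex combination of positive numbers is positive.
  have hconv : ∀ u v : ℝ, 0 < u → 0 < v → 0 < α * u + (1 - α) * v := by
    intro u v hu hv
    rcases hα0.eq_or_lt with h | h
    · simpa [← h] using hv
    · have := mul_pos h hu
      have := mul_nonneg (sub_nonneg.2 hα1) hv.le
      linarith
  refine rank_mul_rank_le (hρ.injective A hA hfin hgr _ _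
      (lt_setDist_interior hr hdisj (hρ.nonneg A hA hfin hgr)))
    (fun a ha => ha.1.1) (fun b hb => hb.1) (fun a ha => ha.1.1) (fun b hb => hb.1)
    (isHomogeneousSubspace_supported (isGraded_genAlg hgr _) _)
    (isHomogeneousSubspace_supportedDeg (isGraded_genAlg hgr _) _ _ _)
    (fun a ha a' ha' => ⟨⟨hmul a ha.1.1 a' ha'.1.1, ?_⟩, ?_⟩)
    (fun b hb b' hb' => ⟨hmul b hb.1 b' hb'.1, ?_⟩)
  · refine (ha.1.2.mul ha'.1.2).mono fun x hx => ?_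
    have h1 : average f₀ Ω x < c + δ := hx.1
    have h2 : average f₀ Ω' x < c' + δ := hx.2
    have := hconv _ _ (sub_pos.2 h1) (sub_pos.2 h2)
    rw [Set.mem_preimage, Set.mem_Iio, average_union f₀ hdisj, ← hα]
    linarith
  · intro n hn
    have := mul_degree_mem ha.2 ha'.2 n hn
    rw [← hαc, ← hαc'] at this
    constructor <;> linarith [this.1, this.2]
  · refine (hb.2.mul hb'.2).mono fun x hx => ?_
    have h1 : c - δ < average f₀ Ω x := hx.1
    have h2 : c' - δ < average f₀ Ω' x := hx.2
    have := hconv _ _ (sub_pos.2 h1) (sub_pos.2 h2)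
    rw [Set.mem_preimage, Set.mem_Ioi, average_union f₀ hdisj, ← hα]
    linarith

end Action

end HomMeasure

end

theorem mainTheorem4 {Γ : Type*} [Group Γ] [Countable Γ] [DecidableEq Γ] [MetricSpace Γ]
    (hd : ∀ g γ γ' : Γ, dist (g * γ) (g * γ') = dist γ γ')
    {X : Type*} [TopologicalSpace X] [CompactSpace X] [MulAction Γ X] [ContinuousConstSMul Γ X]
    {F : Type*} [Field F]
    (f₀ : X → ℝ) (hf₀ : Continuous f₀) (hrange : Set.range f₀ = Set.Icc 0 1)
    (𝔞 : NonUnitalSubalgebra F (HomMeasure.Cohomology F X))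
    (N : NonUnitalSubalgebra F (HomMeasure.Cohomology F X) → ℝ)
    (hρ : HomMeasure.IsProductLike (Γ := Γ) 𝔞 N)
    (A : NonUnitalSubalgebra F (HomMeasure.Cohomology F X)) (hA : A ≤ 𝔞)
    (hfin : FiniteDimensional F A) (hgr : HomMeasure.IsGraded A)
    (r : ℝ) (hr : ∀ γ γ' : Γ, dist γ γ' ≤ N A → ∃ z : Γ, dist γ z ≤ r ∧ dist z γ' ≤ r)
    (ν δ : ℝ) (hν : 0 < ν) (hδ : 0 < δ)
    (Ω Ω' : Finset Γ) (hdisj : Disjoint Ω Ω') :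
    (∀ ℓ c : ℝ, 0 ≤ ℓ → c ∈ Set.Icc (0 : ℝ) 1 →
      HomMeasure.homologicalMeasure f₀ A r Ω ℓ ν c δ *
          HomMeasure.homologicalMeasure f₀ A r Ω' ℓ ν c δ ≤
        HomMeasure.homologicalMeasure f₀ A r (Ω ∪ Ω') ℓ ν c δ) ∧
    (∀ ℓ ℓ' c c' α : ℝ, 0 ≤ ℓ → 0 ≤ ℓ' → c ∈ Set.Icc (0 : ℝ) 1 → c' ∈ Set.Icc (0 : ℝ) 1 →
      α = (Ω.card : ℝ) / ((Ω ∪ Ω').card : ℝ) →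
      HomMeasure.homologicalMeasure f₀ A r Ω ℓ ν c δ *
          HomMeasure.homologicalMeasure f₀ A r Ω' ℓ' ν c' δ ≤
        HomMeasure.homologicalMeasure f₀ A r (Ω ∪ Ω')
          (α * ℓ + (1 - α) * ℓ') ν (α * c + (1 - α) * c') δ) := by
  have key := fun ℓ ℓ' c c' α => HomMeasure.homologicalMeasure_mul_le f₀ hρ hA hfin hgr hr ν δ
    hdisj ℓ ℓ' c c' (α := α)
  refine ⟨fun ℓ c _ _ => ?_, fun ℓ ℓ' c c' α _ _ _ _ hα => key ℓ ℓ' c c' α hα⟩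
  have h := key ℓ ℓ c c _ rfl
  rwa [← add_mul, ← add_mul, add_sub_cancel, one_mul, one_mul] at h
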